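/- **Theorem 4.1.** Let $\mathbb F$ be a field of characteristic $0$, let $r>1$ and $n\ge 0$ be integers with $n\le 5r-3$, and let $(\mathcal A^*,d)$ be an $(r-1)$-connected Poincaré DGCA of degree $n$ over $\mathbb F$: a unital graded commutative differential graded algebra $\mathcal A^*=\bigoplus_{k=0}^n\mathcal A^k$ with $d$ of degree $+1$, whose cohomology $H^*=H^*(\mathcal A^*)$ is finite dimensional and carries a linear form $\int:H^n\to\mathbb F$ such that the pairing $\langle\alpha,\beta\rangle=\int\alpha\beta$ for $\deg\alpha+\deg\beta=n$ (and $0$ for homogeneous elements of other degrees) is non-degenerate on $H^*$, and such that $H^0\cong\mathbb F$ and $H^k=0$ for $1\le k\le r-1$. On $\mathcal A^*$ put $\langle a,b\rangle=\int[ab]$ if $\deg a+\deg b=n$, and $0$ for homogeneous elements of other degrees. Let $\mathcal A^*=d\mathcal A^{*-1}\oplus\mathcal H^*\oplus\mathcal B^*$ be a Hodge type decomposition, i.e. a direct sum decomposition into graded subspaces such that $\mathcal H^*$ is a complement of $d\mathcal A^{*-1}$ in $\ker d$ and $\langle\mathcal H^*\oplus\mathcal B^*,\mathcal B^*\rangle=0$.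 Assume that $\mathcal H^*$ is adapted to a generating subspace: there are a graded subspace $H^*_{gen}$ with $H^*_+=H^*_{gen}\oplus(H^*_+\cdot H^*_+)$, where $H^*_+=\bigoplus_{k\ge1}H^k$, a degree-preserving linear map $\imath_0:H^*_{gen}\to\ker d$ with $[\imath_0(x)]=x$ for all $x$, and a degree-preserving linear map $\imath:H^*\to\ker d$ with $[\imath(x)]=x$ for all $x$, such that $\imath$ extends $\imath_0$, takes its values in the unital subalgebra generated by $\imath_0(H^*_{gen})$, and has image $\mathcal H^*$. Then there is an $A_\infty$-algebra structure $(m_k)_{k\ge1}$ on the graded vector space $\mathcal H^*$ (with $m_k$ of degree $2-k$) such that $m_1=0$ and $m_k=0$ for all $k\ge4$, and such that there is an $A_\infty$-quasi-isomorphism from $(\mathcal H^*,(m_k))$ to $\mathcal A^*$, where $\mathcal A^*$ is viewed as the $A_\infty$-algebra with operations $d$, the product, and $0$ in all higher arities. If moreover $n\le 4r-2$, then this structure can be chosen with $m_3=0$ as well, and $\mathcal A^*$ is formal, i.e. connected to $(H^*(\mathcal A^*),0)$ by a zigzag of quasi-isomorphisms of DGCAs. -/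

import Mathlib

universe u v

/-! ### Graded vector spaces and graded commutative algebras -/

/-- A `ℤ`-graded vector space over `F`: a vector space with a direct sum decomposition. -/
structure GradedSpace (F : Type v) [Field F] : Type (max v (u + 1)) where
  carrier : Type u
  [addCommGroup : AddCommGroup carrier]
  [module : Module F carrier]
  /-- the homogeneous components -/
  gr : ℤ → Submodule F carrier
  [decomposition : DirectSum.Decomposition gr]

/-- A (unital, associative) graded commutative algebra, graded in non-negative degrees. -/
structure GCA (F : Type v) [Field F] : Type (max v (u + 1)) where
  carrier : Type u
  [ring : Ring carrier]
  [algebra : Algebra F carrier]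
  /-- the homogeneous components -/
  gr : ℤ → Submodule F carrier
  [gradedAlgebra : GradedAlgebra gr]
  gr_neg : ∀ i : ℤ, i < 0 → gr i = ⊥
  graded_comm : ∀ (i j : ℤ) (a b : carrier), a ∈ gr i → b ∈ gr j →
    a * b = (i * j).negOnePow • (b * a)

attribute [instance] GradedSpace.addCommGroup GradedSpace.module GradedSpace.decomposition
attribute [instance] GCA.ring GCA.algebra GCA.gradedAlgebra

/-- A differential graded commutative algebra: the differential has degree `+1`. -/
structure DGCA (F : Type v) [Field F] : Type (max v (u + 1)) extends GCA.{u, v} F where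
  d : carrier →ₗ[F] carrier
  d_mem : ∀ (i : ℤ) (a : carrier), a ∈ gr i → d a ∈ gr (i + 1)
  d_d : ∀ a : carrier, d (d a) = 0
  leibniz : ∀ (i : ℤ) (a b : carrier), a ∈ gr i → d (a * b) = d a * b + i.negOnePow • (a * d b)

/-- If `π` is a surjective linear map whose kernel is stable under the projections of a grading,
then the images of the homogeneous components form a grading of the target. -/
theorem isInternal_map_of_projections {F : Type v} [Field F] {M N : Type u}
    [AddCommGroup M] [Module F M] [AddCommGroup N] [Module F N]
    (π : M →ₗ[F] N) (hπ : Function.Surjective π) (gr : ℤ → Submodule F M) (p : ℤ → M →ₗ[F] M)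
    (hsame : ∀ i, ∀ x ∈ gr i, p i x = x) (hne : ∀ i j, j ≠ i → ∀ x ∈ gr j, p i x = 0)
    (htop : ⨆ i, gr i = ⊤) (hker : ∀ i x, π x = 0 → π (p i x) = 0) :
    DirectSum.IsInternal (fun i => (gr i).map π) := by
  apply DirectSum.isInternal_submodule_of_iSupIndep_of_iSup_eq_top
  · intro i
    rw [Submodule.disjoint_def]
    intro y hy hy'
    obtain ⟨x, hx, rfl⟩ := hy
    have h1 : (⨆ j, ⨆ (_ : j ≠ i), (gr j).map π) = (⨆ j, ⨆ (_ : j ≠ i), gr j).map π := by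
      simp only [Submodule.map_iSup]
    rw [h1] at hy'
    obtain ⟨x', hx', hxx⟩ := hy'
    have h2 : (⨆ j, ⨆ (_ : j ≠ i), gr j) ≤ LinearMap.ker (p i) :=
      iSup₂_le fun j hj z hz => hne i j hj z hz
    have h3 : p i x' = 0 := h2 hx'
    have h4 := hker i (x - x') (by rw [map_sub, hxx, sub_self])
    rw [map_sub, h3, sub_zero, hsame i x hx] at h4
    exact h4
  · rw [← Submodule.map_iSup, htop, Submodule.map_top, LinearMap.range_eq_top]
    exact hπ

namespace GCA

variable {F : Type v} [Field F] (A : GCA.{u, v} F)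

/-- The projection onto the component of degree `i`. -/
noncomputable def component (i : ℤ) : A.carrier →ₗ[F] A.gr i :=
  (DirectSum.component F ℤ (fun j => A.gr j) i).comp
    (DirectSum.decomposeLinearEquiv A.gr).toLinearMap

theorem coe_component (i : ℤ) (a : A.carrier) :
    (A.component i a : A.carrier) = (DirectSum.decompose A.gr a i : A.carrier) := rfl

theorem component_same {i : ℤ} {a : A.carrier} (ha : a ∈ A.gr i) :
    (A.component i a : A.carrier) = a := by
  rw [coe_component, DirectSum.decompose_of_mem_same _ ha]

theorem component_ne {i j : ℤ} (h : j ≠ i) {a : A.carrier} (ha : a ∈ A.gr j) :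
    (A.component i a : A.carrier) = 0 := by
  rw [coe_component, DirectSum.decompose_of_mem_ne _ ha h]

/-- The underlying graded vector space. -/
abbrev toGradedSpace : GradedSpace.{u, v} F where
  carrier := A.carrier
  gr := A.gr

/-- A graded commutative algebra as a DGCA with trivial differential. -/
def toDGCA : DGCA.{u, v} F where
  toGCA := A
  d := 0
  d_mem _ _ _ := Submodule.zero_mem _
  d_d _ := rfl
  leibniz _ _ _ _ := by simp

/-- The pairing `⟨α, β⟩ = ∫ (α β)_n` determined by a linear form on the component of degree `n`;
on homogeneous elements it is `∫ α β` if the degrees add up to `n`, and `0` otherwise. -/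
noncomputable def pairing (n : ℕ) (integral : Module.Dual F (A.gr n)) (a b : A.carrier) : F :=
  integral (A.component n (a * b))

/-- `(A, ∫)` is a Poincaré algebra of degree `n`. -/
structure IsPoincare (n : ℕ) (integral : Module.Dual F (A.gr n)) : Prop where
  finite : FiniteDimensional F A.carrier
  bounded : ∀ k : ℤ, n < k → A.gr k = ⊥
  nondegenerate : ∀ a, (∀ b, A.pairing n integral a b = 0) → a = 0

/-- The part of positive degree. -/
def positivePart : Submodule F A.carrier := ⨆ k : ℤ, ⨆ _ : 0 < k, A.gr k

/-- A generating subspace: a graded complement of `A₊ · A₊` in `A₊`. -/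
structure IsGenerating (W : Submodule F A.carrier) : Prop where
  homogeneous : W.IsHomogeneous A.gr
  disjoint : W ⊓ A.positivePart * A.positivePart = ⊥
  span : W ⊔ A.positivePart * A.positivePart = A.positivePart

end GCA

/-! ### Cohomology of a DGCA -/

namespace DGCA

variable {F : Type v} [Field F] (A : DGCA.{u, v} F)

theorem homogeneous_induction {P : A.carrier → Prop} (hom : ∀ i, ∀ a ∈ A.gr i, P a)
    (add : ∀ a b, P a → P b → P (a + b)) (a : A.carrier) : P a :=
  DirectSum.Decomposition.inductionOn A.gr (hom 0 0 (Submodule.zero_mem _))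
    (fun {i} m => hom i m m.2) (fun _ _ => add _ _) a

theorem component_d (i : ℤ) (a : A.carrier) :
    (A.component (i + 1) (A.d a) : A.carrier) = A.d (A.component i a) := by
  induction a using A.homogeneous_induction with
  | hom j a ha =>
    by_cases h : j = i
    · subst h
      rw [A.component_same (A.d_mem j a ha), A.component_same ha]
    · rw [A.component_ne (by omega) (A.d_mem j a ha), A.component_ne h ha, map_zero]
  | add a b ha hb => simp only [map_add, Submodule.coe_add, ha, hb]

theorem d_component_of_cocycle (i : ℤ) {a : A.carrier} (ha : A.d a = 0) :
    A.d (A.component i a) = 0 := by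
  rw [← component_d, ha, map_zero, Submodule.coe_zero]

theorem d_mul_of_cocycle (a : A.carrier) {b : A.carrier} (hb : A.d b = 0) :
    A.d (a * b) = A.d a * b := by
  induction a using A.homogeneous_induction with
  | hom j a ha => rw [A.leibniz j a b ha, hb, mul_zero, smul_zero, add_zero]
  | add a a' ha ha' => simp only [map_add, add_mul, ha, ha']

theorem d_one : A.d 1 = 0 := by
  have h := A.leibniz 0 1 1 (SetLike.GradedOne.one_mem)
  simpa using h

theorem exists_mul_d (a x : A.carrier) (ha : A.d a = 0) : ∃ y, A.d y = a * A.d x := by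
  classical
  have key : ∀ i, ∃ y, A.d y = (A.component i a : A.carrier) * A.d x := by
    intro i
    refine ⟨i.negOnePow • ((A.component i a : A.carrier) * x), ?_⟩
    have h := A.leibniz i _ x (A.component i a).2
    rw [A.d_component_of_cocycle i ha, zero_mul, zero_add] at h
    rw [Units.smul_def, map_zsmul, h, Units.smul_def, smul_smul]
    simp
  choose y hy using key
  refine ⟨∑ i ∈ (DirectSum.decompose A.gr a).support, y i, ?_⟩
  rw [map_sum, Finset.sum_congr rfl (fun i _ => hy i), ← Finset.sum_mul]
  congr 1
  exact DirectSum.sum_support_decompose A.gr a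

/-- The subalgebra of cocycles. -/
def cocycles : Subalgebra F A.carrier where
  carrier := {a | A.d a = 0}
  mul_mem' {a b} ha hb := by
    change A.d (a * b) = 0
    rw [A.d_mul_of_cocycle a hb, show A.d a = 0 from ha, zero_mul]
  add_mem' {a b} ha hb := by
    change A.d (a + b) = 0
    rw [map_add, show A.d a = 0 from ha, show A.d b = 0 from hb, add_zero]
  algebraMap_mem' c := by
    change A.d (algebraMap F A.carrier c) = 0
    rw [Algebra.algebraMap_eq_smul_one, map_smul, A.d_one, smul_zero]

/-- The ideal of coboundaries in the algebra of cocycles. -/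
def coboundaries : Ideal A.cocycles where
  carrier := {a | ∃ x, A.d x = a}
  zero_mem' := ⟨0, map_zero _⟩
  add_mem' := by
    rintro a b ⟨x, hx⟩ ⟨y, hy⟩
    exact ⟨x + y, by rw [map_add, hx, hy]; rfl⟩
  smul_mem' := by
    rintro c a ⟨x, hx⟩
    obtain ⟨y, hy⟩ := A.exists_mul_d c x c.2
    exact ⟨y, by rw [hy, hx]; rfl⟩

instance : A.coboundaries.IsTwoSided where
  mul_mem_of_left := by
    rintro a b ⟨x, hx⟩
    exact ⟨x * b, by rw [A.d_mul_of_cocycle x b.2, hx]; rfl⟩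

/-- The projection `pr` from cocycles to cohomology classes. -/
noncomputable def pr : A.cocycles →ₐ[F] (A.cocycles ⧸ A.coboundaries) :=
  Ideal.Quotient.mkₐ F A.coboundaries

theorem pr_surjective : Function.Surjective A.pr := Ideal.Quotient.mk_surjective

theorem pr_eq_zero_iff (z : A.cocycles) : A.pr z = 0 ↔ ∃ x, A.d x = z :=
  Ideal.Quotient.eq_zero_iff_mem

/-- The cocycles of degree `i`. -/
def cocyclesGr (i : ℤ) : Submodule F A.cocycles := (A.gr i).comap A.cocycles.val.toLinearMap

/-- The cohomology classes of degree `i`. -/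
noncomputable def cohomologyGr (i : ℤ) : Submodule F (A.cocycles ⧸ A.coboundaries) :=
  (A.cocyclesGr i).map A.pr.toLinearMap

/-- The homogeneous component of a cocycle, as a cocycle. -/
noncomputable def cocyclesProj (i : ℤ) : A.cocycles →ₗ[F] A.cocycles where
  toFun z := ⟨A.component i z, A.d_component_of_cocycle i z.2⟩
  map_add' x y := by ext; simp
  map_smul' c x := by ext; simp

theorem cohomology_isInternal : DirectSum.IsInternal A.cohomologyGr := by
  classical
  refine isInternal_map_of_projections A.pr.toLinearMap A.pr_surjective A.cocyclesGr
    A.cocyclesProj ?_ ?_ ?_ ?_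
  · intro i x hx
    exact Subtype.ext (A.component_same hx)
  · intro i j hj x hx
    exact Subtype.ext (A.component_ne hj hx)
  · rw [eq_top_iff]
    intro z _
    have h : z = ∑ i ∈ (DirectSum.decompose A.gr (z : A.carrier)).support, A.cocyclesProj i z := by
      ext
      rw [AddSubmonoidClass.coe_finsetSum]
      exact (DirectSum.sum_support_decompose A.gr (z : A.carrier)).symm
    rw [h]
    exact Submodule.sum_mem _ fun i _ =>
      Submodule.mem_iSup_of_mem i (A.component i (z : A.carrier)).2
  · intro i x hx
    obtain ⟨y, hy⟩ := (A.pr_eq_zero_iff x).1 hx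
    refine (A.pr_eq_zero_iff _).2 ⟨A.component (i - 1) y, ?_⟩
    rw [← A.component_d, hy, sub_add_cancel]
    rfl

noncomputable instance cohomologyGradedAlgebra : GradedAlgebra A.cohomologyGr where
  toDecomposition := A.cohomology_isInternal.chooseDecomposition
  one_mem := ⟨1, show (1 : A.carrier) ∈ A.gr 0 from SetLike.GradedOne.one_mem, map_one A.pr⟩
  mul_mem := by
    rintro i j _ _ ⟨x, hx, rfl⟩ ⟨y, hy, rfl⟩
    exact ⟨x * y, show (x * y : A.carrier) ∈ A.gr (i + j) from SetLike.GradedMul.mul_mem hx hy,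
      map_mul A.pr x y⟩

/-- The cohomology algebra of a DGCA. -/
noncomputable def cohomology : GCA.{u, v} F where
  carrier := A.cocycles ⧸ A.coboundaries
  gr := A.cohomologyGr
  gr_neg i hi := by
    rw [eq_bot_iff]
    rintro _ ⟨x, hx, rfl⟩
    have hx' : (x : A.carrier) ∈ A.gr i := hx
    rw [A.gr_neg i hi, Submodule.mem_bot] at hx'
    have : x = 0 := Subtype.ext hx'
    rw [this, map_zero]
    exact Submodule.zero_mem _
  graded_comm := by
    rintro i j _ _ ⟨x, hx, rfl⟩ ⟨y, hy, rfl⟩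
    have h : x * y = (i * j).negOnePow • (y * x) := Subtype.ext (A.graded_comm i j x y hx hy)
    change A.pr x * A.pr y = (i * j).negOnePow • (A.pr y * A.pr x)
    rw [← map_mul, h, Units.smul_def, map_zsmul, map_mul, Units.smul_def]

/-- `A` is `k`-connected: `H⁰(A) ≅ F` and `Hⁱ(A) = 0` for `1 ≤ i ≤ k`. -/
def IsConnectedUpTo (k : ℕ) : Prop :=
  Nonempty (A.cohomology.gr 0 ≃ₗ[F] F) ∧ ∀ i : ℤ, 1 ≤ i → i ≤ k → A.cohomology.gr i = ⊥

/-- A harmonic subspace: a graded subspace of the cocycles, complementary to the coboundaries. -/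
structure IsHarmonic (ℋ : Submodule F A.carrier) : Prop where
  homogeneous : ℋ.IsHomogeneous A.gr
  disjoint : ℋ ⊓ LinearMap.range A.d = ⊥
  span : ℋ ⊔ LinearMap.range A.d = LinearMap.ker A.d

/-- A partial splitting map on a graded subspace `W` of the cohomology: a linear map of degree `0`
choosing a representing cocycle for every class in `W`. -/
structure IsPartialSplitting (W : Submodule F A.cohomology.carrier) (i₀ : W →ₗ[F] A.cocycles) :
    Prop where
  degree : ∀ (k : ℤ) (w : W), (w : A.cohomology.carrier) ∈ A.cohomology.gr k →
    (i₀ w : A.carrier) ∈ A.gr k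
  section_pr : ∀ w : W, A.pr (i₀ w) = (w : A.cohomology.carrier)

/-- A splitting map of `A`: a linear section of degree `0` of the projection from cocycles to
cohomology. -/
structure IsSplitting (i : A.cohomology.carrier →ₗ[F] A.cocycles) : Prop where
  degree : ∀ (k : ℤ), ∀ w ∈ A.cohomology.gr k, (i w : A.carrier) ∈ A.gr k
  section_pr : ∀ w, A.pr (i w) = w

/-- The subspace `ℋ` is adapted to the subspace `W` of the cohomology: it is the image of a
splitting map extending a partial splitting map `i₀` of `W` and taking its values in the algebra
generated by `i₀(W)` (which is the image of the graded symmetric algebra of `W`). -/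
def IsAdapted (ℋ : Submodule F A.carrier) (W : Submodule F A.cohomology.carrier) : Prop :=
  ∃ (i₀ : W →ₗ[F] A.cocycles) (i : A.cohomology.carrier →ₗ[F] A.cocycles),
    A.IsPartialSplitting W i₀ ∧ A.IsSplitting i ∧ (∀ w : W, i w = i₀ w) ∧
    (∀ x, i x ∈ Algebra.adjoin F (Set.range i₀)) ∧
    ℋ = LinearMap.range (A.cocycles.val.toLinearMap ∘ₗ i)

end DGCA

/-! ### Quasi-isomorphisms and formality -/

/-- `f : (V, d) → (W, d')` commutes with the differentials and induces a bijection
`ker d / im d → ker d' / im d'`. -/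
structure InducesCohomologyIso {F : Type v} [Field F] {V W : Type u}
    [AddCommGroup V] [Module F V] [AddCommGroup W] [Module F W]
    (d : V →ₗ[F] V) (d' : W →ₗ[F] W) (f : V →ₗ[F] W) : Prop where
  comm : ∀ x, f (d x) = d' (f x)
  injective : ∀ x, d x = 0 → (∃ y, d' y = f x) → ∃ z, d z = x
  surjective : ∀ y, d' y = 0 → ∃ x, d x = 0 ∧ ∃ z, d' z = y - f x

namespace DGCA

variable {F : Type v} [Field F]

/-- There is a quasi-isomorphism of DGCAs (a unital algebra homomorphism of degree `0`, commuting
with the differentials and inducing an isomorphism in cohomology) from `A` to `B`. -/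
def ExistsQuasiIso (A B : DGCA.{u, v} F) : Prop :=
  ∃ f : A.carrier →ₐ[F] B.carrier, (∀ (i : ℤ), ∀ a ∈ A.gr i, f a ∈ B.gr i) ∧
    InducesCohomologyIso A.d B.d f.toLinearMap

/-- Equivalence of DGCAs: the equivalence relation generated by quasi-isomorphisms. -/
def Equivalent : DGCA.{u, v} F → DGCA.{u, v} F → Prop := Relation.EqvGen ExistsQuasiIso

/-- A DGCA is formal if it is equivalent to its cohomology algebra with trivial differential. -/
def IsFormal (A : DGCA.{u, v} F) : Prop := Equivalent A A.cohomology.toDGCA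

end DGCA

/-! ### Poincaré DGCAs and Hodge type decompositions -/

/-- A Poincaré DGCA of degree `n`. -/
structure PoincareDGCA (F : Type v) [Field F] (n : ℕ) : Type (max v (u + 1))
    extends DGCA.{u, v} F where
  bounded : ∀ k : ℤ, n < k → gr k = ⊥
  /-- the linear form on the cohomology of degree `n` -/
  integral : Module.Dual F (toDGCA.cohomology.gr n)
  poincare : toDGCA.cohomology.IsPoincare n integral

namespace PoincareDGCA

variable {F : Type v} [Field F] {n : ℕ} (A : PoincareDGCA.{u, v} F n)

/-- The component of degree `n` of an element, as a cocycle. -/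
noncomputable def topCocycle : A.carrier →ₗ[F] A.cocycles where
  toFun a := ⟨A.component n a, by
    have h := A.d_mem n _ (A.component n a).2
    rwa [A.bounded (n + 1) (by omega), Submodule.mem_bot] at h⟩
  map_add' x y := by ext; simp
  map_smul' c x := by ext; simp

/-- The pairing on `A`, `⟨a, b⟩ = ∫ [(a b)_n]`; on homogeneous elements it is `∫ [a b]` if the
degrees add up to `n`, and `0` otherwise. -/
noncomputable def pairing (a b : A.carrier) : F :=
  A.integral (A.cohomology.component n (A.pr (A.topCocycle (a * b))))

/-- A Hodge type decomposition `A = dA ⊕ ℋ ⊕ ℬ`. -/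
structure HodgeDecomposition where
  harmonic : Submodule F A.carrier
  coexact : Submodule F A.carrier
  isHarmonic : A.IsHarmonic harmonic
  coexact_homogeneous : coexact.IsHomogeneous A.gr
  isInternal : DirectSum.IsInternal ![LinearMap.range A.d, harmonic, coexact]
  orthogonal : ∀ x ∈ harmonic ⊔ coexact, ∀ y ∈ coexact, A.pairing x y = 0

end PoincareDGCA

/-! ### `A_∞`-algebras and `A_∞`-morphisms -/

/-- A homogeneous subspace with the induced grading is internally graded. -/
theorem GCA.isInternal_of_isHomogeneous {F : Type v} [Field F] (A : GCA.{u, v} F)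
    (P : Submodule F A.carrier) (hP : P.IsHomogeneous A.gr) :
    DirectSum.IsInternal (fun i => (A.gr i).comap P.subtype) := by
  classical
  let q : ℤ → P →ₗ[F] P := fun i =>
    { toFun := fun z => ⟨A.component i z, hP i z.2⟩
      map_add' := fun x y => by ext; simp
      map_smul' := fun c x => by ext; simp }
  have h := isInternal_map_of_projections (LinearMap.id (R := F) (M := P)) (fun x => ⟨x, rfl⟩)
    (fun i => (A.gr i).comap P.subtype) q
    (fun i x hx => Subtype.ext (A.component_same hx))
    (fun i j hj x hx => Subtype.ext (A.component_ne hj hx))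
    (by
      rw [eq_top_iff]
      intro z _
      have h : z = ∑ i ∈ (DirectSum.decompose A.gr (z : A.carrier)).support, q i z := by
        ext
        rw [AddSubmonoidClass.coe_finsetSum]
        exact (DirectSum.sum_support_decompose A.gr (z : A.carrier)).symm
      rw [h]
      exact Submodule.sum_mem _ fun i _ =>
        Submodule.mem_iSup_of_mem i (A.component i (z : A.carrier)).2)
    (fun i x hx => by rw [show x = 0 from hx, map_zero, map_zero])
  simpa only [Submodule.map_id] using h

/-- The harmonic subspace as a graded vector space, with the grading induced from `A`. -/
noncomputable def PoincareDGCA.HodgeDecomposition.harmonicSpace {F : Type v} [Field F] {n : ℕ}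
    {A : PoincareDGCA.{u, v} F n} (D : A.HodgeDecomposition) : GradedSpace.{u, v} F where
  carrier := D.harmonic
  gr i := (A.gr i).comap D.harmonic.subtype
  decomposition :=
    (A.isInternal_of_isHomogeneous D.harmonic D.isHarmonic.homogeneous).chooseDecomposition

/-- `k`-linear maps from `V` to `W`. -/
abbrev KLinear {F : Type v} [Field F] (V W : GradedSpace.{u, v} F) (k : ℕ) : Type u :=
  MultilinearMap F (fun _ : Fin k => V.carrier) W.carrier

/-- The unary operation as a linear map. -/
def KLinear.linear {F : Type v} [Field F] {V W : GradedSpace.{u, v} F} (f : KLinear V W 1) :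
    V.carrier →ₗ[F] W.carrier where
  toFun x := f fun _ => x
  map_add' x y := by
    have e : ∀ z : V.carrier, Function.update (fun _ : Fin 1 => (0 : V.carrier)) 0 z = fun _ => z :=
      fun z => funext fun i => by rw [Subsingleton.elim i 0, Function.update_self]
    have h := f.map_update_add (fun _ => 0) 0 x y
    rwa [e, e, e] at h
  map_smul' c x := by
    have e : ∀ z : V.carrier, Function.update (fun _ : Fin 1 => (0 : V.carrier)) 0 z = fun _ => z :=
      fun z => funext fun i => by rw [Subsingleton.elim i 0, Function.update_self]
    have h := f.map_update_smul (fun _ => 0) 0 c x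
    rwa [e, e] at h

/-- The sequence `a₀, …, a_{r-1}, x, a_{r+s}, a_{r+s+1}, …`: the `s` entries with the indices
`r, …, r+s-1` are replaced by the single entry `x` (for `s ≥ 1`). -/
def spliceSeq {V : Type u} (a : ℕ → V) (r s : ℕ) (x : V) : ℕ → V := fun i =>
  if i < r then a i else if i = r then x else a (i + s - 1)

/-- For a family `f` of operations and a family `m` of operations of degrees `2 - s`, the value
`∑_{r+s+t=N} (-1)^{r+st} f_{r+1+t}(1^{⊗r} ⊗ m_s ⊗ 1^{⊗t})(a₀ ⊗ … ⊗ a_{N-1})`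
for homogeneous `a_i` of degrees `p i`. By the Koszul sign rule, moving `m_s` past
`a₀ ⊗ … ⊗ a_{r-1}` yields the additional sign `(-1)^{(2-s)(p₀+…+p_{r-1})}`. -/
def insertionSum {F : Type v} [Field F] {V W : GradedSpace.{u, v} F}
    (f : ∀ k, KLinear V W k) (m : ∀ k, KLinear V V k) (N : ℕ) (p : ℕ → ℤ) (a : ℕ → V.carrier) :
    W.carrier :=
  ∑ r ∈ Finset.range N, ∑ s ∈ Finset.Icc 1 (N - r),
    ((r : ℤ) + s * ((N - r - s : ℕ) : ℤ) + (2 - s) * ∑ i ∈ Finset.range r, p i).negOnePow •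
      f (r + 1 + (N - r - s)) fun i => spliceSeq a r s (m s fun j => a (r + j)) i

/-- For a family `m` of operations and a family `f` of maps of degrees `1 - i`, the value
`∑_{i₁+…+i_j=N} (-1)^u m_j(f_{i₁} ⊗ … ⊗ f_{i_j})(a₀ ⊗ … ⊗ a_{N-1})`, `u = ∑_k (j-k)(i_k-1)`,
for homogeneous `a_i` of degrees `p i`; the sum runs over all compositions of `N`. By the Koszul
sign rule, moving `f_{i_k}` past the arguments of the preceding blocks yields an additional
factor `-1` to the power `(1-i_k)` times the sum of their degrees. Here `k` is counted from `0`,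
the block number `k` has size `c.blocksFun k` and is preceded by `c.sizeUpTo k` arguments. -/
def compositionSum {F : Type v} [Field F] {V W : GradedSpace.{u, v} F}
    (m : ∀ k, KLinear W W k) (f : ∀ k, KLinear V W k) (N : ℕ) (p : ℕ → ℤ) (a : ℕ → V.carrier) :
    W.carrier :=
  ∑ c : Composition N,
    (∑ k : Fin c.length, (((c.length : ℤ) - 1 - (k : ℕ)) * ((c.blocksFun k : ℤ) - 1) +
      (1 - (c.blocksFun k : ℤ)) * ∑ i ∈ Finset.range (c.sizeUpTo k), p i)).negOnePow •
      m c.length fun k => f (c.blocksFun k) fun x => a (c.sizeUpTo k + x)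

/-- A family of multilinear maps in which the `k`-ary one has degree `e - k`. -/
def HasDegree {F : Type v} [Field F] {V W : GradedSpace.{u, v} F} (f : ∀ k, KLinear V W k)
    (e : ℤ) : Prop :=
  ∀ (k : ℕ) (p : ℕ → ℤ) (a : ℕ → V.carrier), (∀ i, a i ∈ V.gr (p i)) →
    f k (fun i => a i) ∈ W.gr (∑ i ∈ Finset.range k, p i + e - k)

/-- An `A_∞`-algebra structure on a graded vector space: operations `m_k` (`k ≥ 1`) of degree
`2 - k` satisfying the Stasheff identities. (The value at `k = 0` is a dummy. The arguments are
the first entries of an infinite sequence; the remaining entries play no role.) -/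
structure AInfinityStructure {F : Type v} [Field F] (V : GradedSpace.{u, v} F) where
  m : ∀ k, KLinear V V k
  m_zero : m 0 = 0
  degree : HasDegree m 2
  stasheff : ∀ (N : ℕ), 1 ≤ N → ∀ (p : ℕ → ℤ) (a : ℕ → V.carrier), (∀ i, a i ∈ V.gr (p i)) →
    insertionSum m m N p a = 0

/-- An `A_∞`-morphism: maps `f_k` (`k ≥ 1`) of degree `1 - k` compatible with the operations. -/
structure AInfinityHom {F : Type v} [Field F] {V W : GradedSpace.{u, v} F}
    (M : AInfinityStructure V) (M' : AInfinityStructure W) where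
  f : ∀ k, KLinear V W k
  f_zero : f 0 = 0
  degree : HasDegree f 1
  compat : ∀ (N : ℕ), 1 ≤ N → ∀ (p : ℕ → ℤ) (a : ℕ → V.carrier), (∀ i, a i ∈ V.gr (p i)) →
    insertionSum f M.m N p a = compositionSum M'.m f N p a

/-- An `A_∞`-quasi-isomorphism: the linear part induces an isomorphism in cohomology. -/
def AInfinityHom.IsQuasiIso {F : Type v} [Field F] {V W : GradedSpace.{u, v} F}
    {M : AInfinityStructure V} {M' : AInfinityStructure W} (φ : AInfinityHom M M') : Prop :=
  InducesCohomologyIso (M.m 1).linear (M'.m 1).linear (φ.f 1).linear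

namespace DGCA

variable {F : Type v} [Field F] (A : DGCA.{u, v} F)

/-- The operations of a DGCA as an `A_∞`-algebra: `m₁ = d`, `m₂` is the product, and the other
operations vanish. -/
noncomputable def ops : ∀ k, KLinear A.toGradedSpace A.toGradedSpace k
  | 1 => A.d.compMultilinearMap (MultilinearMap.mkPiAlgebraFin F 1 A.carrier)
  | 2 => MultilinearMap.mkPiAlgebraFin F 2 A.carrier
  | _ => 0

/-- The values of the operations of a DGCA on the first entries of a sequence. -/
def opSeq (k : ℕ) (a : ℕ → A.carrier) : A.carrier :=
  if k = 1 then A.d (a 0) else if k = 2 then a 0 * a 1 else 0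

theorem ops_apply (k : ℕ) (a : ℕ → A.carrier) : A.ops k (fun i => a i) = A.opSeq k a := by
  match k with
  | 0 => rfl
  | 1 =>
    change A.d (MultilinearMap.mkPiAlgebraFin F 1 A.carrier fun i : Fin 1 => a i) = A.d (a 0)
    rw [MultilinearMap.mkPiAlgebraFin_apply]
    simp
  | 2 =>
    change (MultilinearMap.mkPiAlgebraFin F 2 A.carrier fun i : Fin 2 => a i) = a 0 * a 1
    rw [MultilinearMap.mkPiAlgebraFin_apply]
    simp
  | k + 3 => rfl

theorem ops_hasDegree : HasDegree A.ops 2 := by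
  intro k p a ha
  rw [ops_apply]
  match k with
  | 0 => simp [opSeq]
  | 1 =>
    have h := A.d_mem _ _ (ha 0)
    have e : ∑ i ∈ Finset.range 1, p i + 2 - ((1 : ℕ) : ℤ) = p 0 + 1 := by simp; ring
    rw [e]
    simpa [opSeq] using h
  | 2 =>
    have h : a 0 * a 1 ∈ A.gr (p 0 + p 1) := SetLike.GradedMul.mul_mem (ha 0) (ha 1)
    simpa [opSeq, Finset.sum_range_succ] using h
  | k + 3 => simp [opSeq]

theorem ops_stasheff (N : ℕ) (hN : 1 ≤ N) (p : ℕ → ℤ) (a : ℕ → A.carrier)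
    (ha : ∀ i, a i ∈ A.gr (p i)) : insertionSum A.ops A.ops N p a = 0 := by
  have hin : ∀ r s, (A.ops s fun j => a (r + j)) = A.opSeq s fun j => a (r + j) :=
    fun r s => A.ops_apply s fun j => a (r + j)
  unfold insertionSum
  simp only [ops_apply, hin]
  by_cases h4 : 4 ≤ N
  · refine Finset.sum_eq_zero fun r hr => Finset.sum_eq_zero fun s hs => ?_
    rw [Finset.mem_range] at hr
    rw [Finset.mem_Icc] at hs
    have h0 : A.opSeq (r + 1 + (N - r - s))
        (spliceSeq a r s (A.opSeq s fun j => a (r + j))) = 0 := by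
      by_cases hs3 : 3 ≤ s
      · have hz : (A.opSeq s fun j => a (r + j)) = 0 := by
          unfold opSeq
          rw [if_neg (by omega), if_neg (by omega)]
        rw [hz]
        unfold opSeq spliceSeq
        rcases r with _ | _ | r
        · simp
        · rw [if_neg (by omega)]
          simp
        · rw [if_neg (by omega), if_neg (by omega)]
      · unfold opSeq
        rw [if_neg (by omega), if_neg (by omega)]
    rw [h0, smul_zero]
  · interval_cases N
    · simp [opSeq, spliceSeq, A.d_d]
    · have h := A.leibniz (p 0) (a 0) (a 1) (ha 0)
      have e1 : Finset.Icc 1 2 = {1, 2} := rfl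
      simp [opSeq, spliceSeq, Finset.sum_range_succ, e1, h, Int.negOnePow_add]
    · have e1 : Finset.Icc 1 2 = {1, 2} := rfl
      have e2 : Finset.Icc 1 3 = {1, 2, 3} := rfl
      simp [opSeq, spliceSeq, Finset.sum_range_succ, e1, e2, Int.negOnePow_add, mul_assoc,
        Int.negOnePow_even 2 even_two]

/-- A DGCA as an `A_∞`-algebra. -/
noncomputable def toAInfinity : AInfinityStructure A.toGradedSpace where
  m := A.ops
  m_zero := rfl
  degree := A.ops_hasDegree
  stasheff := A.ops_stasheff

end DGCA

/-!
# Transferred `A_∞`-structures on the cohomology of highly connected Poincaré DGCAs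

A Hodge type decomposition `A = dA ⊕ ℋ ⊕ ℬ` yields a contraction of `A` onto `ℋ`: the homotopy `h`
inverts `d : ℬ → dA` and vanishes on `ℋ ⊕ ℬ`, so that `h² = 0` and `d h + h d = 1 - proj`. Homotopy
transfer along it gives an `A_∞`-structure on `ℋ` and an `A_∞`-quasi-isomorphism to `A`. With
suspended signs, the components of the latter are `φ₁ = inc` and `φ_N = h λ_N`, where
`λ_N = ∑ ± φ_i φ_{N-i}`, and the operations are `b_N = -proj λ_N`. The equation `d φ = φ ∘ b + λ`
follows by induction on the arity, from the facts that insertion of `b` is a derivation of the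
convolution product and that the product of `A` is associative (`Contraction.d_phi`). The Stasheff
identities are a consequence of it (`Contraction.insertion_bar`). The passage to unsuspended
signs is `insertionSum_unsuspend`.

The operations of arity `k ≥ 3` vanish for reasons of degree
(`HodgeDecomposition.transfer_m_eq_zero`). As `h² = 0` and `proj h = 0`, they vanish if an
argument is a multiple of the unit. Otherwise all arguments have degree at least `r`, and the
value has degree at least `k (r - 1) + 2`. By Poincaré duality and connectivity the cohomology
vanishes in the degrees strictly between `n - r` and `n`. In degree `n` the value has integral
zero, since each summand of `λ_k` is a product of an element of `ℬ` and one of `ℋ ⊕ ℬ`. This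
covers `k ≥ 4` if `n ≤ 5r - 3`, and `k = 3` if `n ≤ 4r - 2`.

For formality in case `n ≤ 4r - 2`, consider the elements of `A` which are harmonic in degrees
`≤ 2r - 2` and whose component of degree `2r - 1` lies in `ℋ ⊕ ℬ`. By connectivity they form a
subalgebra (`HodgeDecomposition.mul_mem_small`); it is stable under `d` and `h` and contains `ℋ`, so
its inclusion into `A` is a quasi-isomorphism. Its non-harmonic part lies in the image of `h`, in
degrees `≥ 2r - 1`, and in the image of `d h`, in degrees `≥ 2r`. As `4r - 1 > n`, this part pairs
trivially with the whole subalgebra. Hence it is an ideal, and taking the class of the harmonic part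
is a multiplicative quasi-isomorphism from the subalgebra to the cohomology algebra.
-/

/-! ### Maps on words -/

namespace WordMap

variable {V W R : Type*}

/-- A family `G` of maps on sequences is local if its `N`-th member depends on the first `N` entries
only, so that it is a family of maps on words of length `N`. -/
def IsLocal (G : ℕ → (ℕ → V) → W) : Prop :=
  ∀ (N : ℕ) (a a' : ℕ → V), (∀ i < N, a i = a' i) → G N a = G N a'

/-- The convolution product: the sum over all ways to cut a word into two nonempty pieces. -/
def conv [NonUnitalNonAssocSemiring R] (G K : ℕ → (ℕ → V) → R) (N : ℕ) (a : ℕ → V) : R :=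
  ∑ i ∈ Finset.Ico 1 N, G i a * K (N - i) fun j => a (i + j)

/-- The word obtained from `a` by applying `σ` to the first `r` letters and by replacing
the following `s` letters by the single letter `b_s(a_r, …, a_{r+s-1})`. -/
def insertSeq (σ : V → V) (b : ℕ → (ℕ → V) → V) (a : ℕ → V) (r s : ℕ) : ℕ → V :=
  spliceSeq (fun i => if i < r then σ (a i) else a i) r s (b s fun j => a (r + j))

/-- Precomposition of `G` with the coderivation of the tensor coalgebra determined by `b`.
The map `σ` carries the Koszul sign of moving `b` past a letter. -/
def insertion [AddCommMonoid W] (σ : V → V) (b : ℕ → (ℕ → V) → V) (G : ℕ → (ℕ → V) → W)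
    (N : ℕ) (a : ℕ → V) : W :=
  ∑ r ∈ Finset.range N, ∑ s ∈ Finset.Icc 1 (N - r),
    G (r + 1 + (N - r - s)) (insertSeq σ b a r s)

theorem insertSeq_of_lt {σ : V → V} {b : ℕ → (ℕ → V) → V} {a : ℕ → V} {r s i : ℕ} (h : i < r) :
    insertSeq σ b a r s i = σ (a i) := by
  simp [insertSeq, spliceSeq, h]

theorem insertSeq_self {σ : V → V} {b : ℕ → (ℕ → V) → V} {a : ℕ → V} {r s : ℕ} :
    insertSeq σ b a r s r = b s fun j => a (r + j) := by
  simp [insertSeq, spliceSeq]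

theorem insertSeq_of_gt {σ : V → V} {b : ℕ → (ℕ → V) → V} {a : ℕ → V} {r s i : ℕ} (hs : 1 ≤ s)
    (h : r < i) : insertSeq σ b a r s i = a (i + s - 1) := by
  have h1 : ¬ i < r := by omega
  have h2 : ¬ i = r := by omega
  have h3 : ¬ i + s - 1 < r := by omega
  simp [insertSeq, spliceSeq, h1, h2, h3]

theorem insertSeq_shift_of_le {σ : V → V} {b : ℕ → (ℕ → V) → V} {a : ℕ → V} {r s i : ℕ}
    (hs : 1 ≤ s) (h : i ≤ r) :
    (fun j => insertSeq σ b a r s (i + j)) = insertSeq σ b (fun j => a (i + j)) (r - i) s := by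
  funext j
  rcases lt_trichotomy j (r - i) with hj | hj | hj
  · rw [insertSeq_of_lt hj, insertSeq_of_lt (by omega)]
  · subst hj
    rw [insertSeq_self, show i + (r - i) = r by omega, insertSeq_self]
    congr 1
    funext j
    congr 1
    omega
  · rw [insertSeq_of_gt hs hj, insertSeq_of_gt hs (by omega)]
    congr 1
    omega

theorem insertSeq_shift_of_gt {σ : V → V} {b : ℕ → (ℕ → V) → V} {a : ℕ → V} {r s i : ℕ}
    (hs : 1 ≤ s) (h : r < i) :
    (fun j => insertSeq σ b a r s (i + j)) = fun j => a (i + s - 1 + j) := by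
  funext j
  rw [insertSeq_of_gt hs (by omega)]
  congr 1
  omega

/-- Insertion is a derivation of the convolution product. -/
theorem insertion_conv [NonUnitalNonAssocSemiring R] (σ : V → V) (b : ℕ → (ℕ → V) → V)
    {G K : ℕ → (ℕ → V) → R} (hG : IsLocal G) (N : ℕ) (a : ℕ → V) :
    insertion σ b (conv G K) N a =
      conv (insertion σ b G) K N a +
        conv (fun i c => G i fun j => σ (c j)) (insertion σ b K) N a := by
  -- The word is cut behind the inserted letter in the first sum, before it in the second one.
  have split : ∀ r ∈ Finset.range N, ∀ s ∈ Finset.Icc 1 (N - r),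
      conv G K (r + 1 + (N - r - s)) (insertSeq σ b a r s) =
        ∑ i ∈ Finset.Ico (r + 1) (r + 1 + (N - r - s)), G i (insertSeq σ b a r s) *
            K (r + 1 + (N - r - s) - i) (fun j => insertSeq σ b a r s (i + j)) +
        ∑ i ∈ Finset.Ico 1 (r + 1), G i (insertSeq σ b a r s) *
            K (r + 1 + (N - r - s) - i) (fun j => insertSeq σ b a r s (i + j)) := by
    intro r _ s _
    exact ((add_comm _ _).trans (Finset.sum_Ico_consecutive _ (by omega) (by omega))).symm
  rw [insertion, Finset.sum_congr rfl fun r hr => Finset.sum_congr rfl (split r hr)]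
  simp only [Finset.sum_add_distrib]
  simp only [conv, insertion, Finset.sum_mul, Finset.mul_sum, Finset.sum_sigma']
  congr 1
  · refine Finset.sum_nbij' (fun x => ⟨x.2.2 + x.2.1 - 1, x.1, x.2.1⟩)
      (fun y => ⟨y.2.1, y.2.2, y.1 + 1 - y.2.2⟩) ?_ ?_ ?_ ?_ ?_
    · rintro ⟨r, s, i⟩ h
      simp only [Finset.mem_sigma, Finset.mem_range, Finset.mem_Icc, Finset.mem_Ico] at h ⊢
      omega
    · rintro ⟨i, r, s⟩ h
      simp only [Finset.mem_sigma, Finset.mem_range, Finset.mem_Icc, Finset.mem_Ico] at h ⊢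
      omega
    · rintro ⟨r, s, i⟩ h
      simp only [Finset.mem_sigma, Finset.mem_range, Finset.mem_Icc, Finset.mem_Ico] at h
      simp only [Sigma.mk.injEq, heq_eq_eq, true_and]
      omega
    · rintro ⟨i, r, s⟩ h
      simp only [Finset.mem_sigma, Finset.mem_range, Finset.mem_Icc, Finset.mem_Ico] at h
      simp only [Sigma.mk.injEq, heq_eq_eq, and_true]
      omega
    · rintro ⟨r, s, i⟩ h
      simp only [Finset.mem_sigma, Finset.mem_range, Finset.mem_Icc, Finset.mem_Ico] at h
      simp only
      rw [insertSeq_shift_of_gt (by omega) (by omega),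
        show r + 1 + (i + s - 1 - r - s) = i by omega,
        show N - (i + s - 1) = r + 1 + (N - r - s) - i by omega]
  · refine Finset.sum_nbij' (fun x => ⟨x.2.2, x.1 - x.2.2, x.2.1⟩)
      (fun y => ⟨y.1 + y.2.1, y.2.2, y.1⟩) ?_ ?_ ?_ ?_ ?_
    · rintro ⟨r, s, i⟩ h
      simp only [Finset.mem_sigma, Finset.mem_range, Finset.mem_Icc, Finset.mem_Ico] at h ⊢
      omega
    · rintro ⟨i, r, s⟩ h
      simp only [Finset.mem_sigma, Finset.mem_range, Finset.mem_Icc, Finset.mem_Ico] at h ⊢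
      omega
    · rintro ⟨r, s, i⟩ h
      simp only [Finset.mem_sigma, Finset.mem_range, Finset.mem_Icc, Finset.mem_Ico] at h
      simp only [Sigma.mk.injEq, heq_eq_eq, and_true]
      omega
    · rintro ⟨i, r, s⟩ h
      simp only [Finset.mem_sigma, Finset.mem_range, Finset.mem_Icc, Finset.mem_Ico] at h
      simp only [Sigma.mk.injEq, heq_eq_eq, and_true, true_and]
      omega
    · rintro ⟨r, s, i⟩ h
      simp only [Finset.mem_sigma, Finset.mem_range, Finset.mem_Icc, Finset.mem_Ico] at h
      simp only
      rw [insertSeq_shift_of_le (by omega) (by omega),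
        show r - i + 1 + (N - i - (r - i) - s) = r + 1 + (N - r - s) - i by omega]
      congr 1
      exact hG _ _ _ fun j hj => insertSeq_of_lt (by omega)

theorem conv_assoc [NonUnitalSemiring R] (G K L : ℕ → (ℕ → V) → R) (N : ℕ) (a : ℕ → V) :
    conv (conv G K) L N a = conv G (conv K L) N a := by
  simp only [conv, Finset.sum_mul, Finset.mul_sum, Finset.sum_sigma']
  refine Finset.sum_nbij' (fun x => ⟨x.2, x.1 - x.2⟩) (fun y => ⟨y.1 + y.2, y.1⟩) ?_ ?_ ?_ ?_ ?_
  · rintro ⟨i, j⟩ h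
    simp only [Finset.mem_sigma, Finset.mem_Ico] at h ⊢
    omega
  · rintro ⟨i, j⟩ h
    simp only [Finset.mem_sigma, Finset.mem_Ico] at h ⊢
    omega
  · rintro ⟨i, j⟩ h
    simp only [Finset.mem_sigma, Finset.mem_Ico] at h
    simp only [Sigma.mk.injEq, heq_eq_eq, and_true]
    omega
  · rintro ⟨i, j⟩ h
    simp only [Finset.mem_sigma, Finset.mem_Ico] at h
    simp only [Sigma.mk.injEq, heq_eq_eq, true_and]
    omega
  · rintro ⟨i, j⟩ h
    simp only [Finset.mem_sigma, Finset.mem_Ico] at h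
    simp only
    rw [show N - j - (i - j) = N - i by omega, mul_assoc]
    congr 3
    funext k
    congr 1
    omega

/-- A family of maps on words is multilinear if its `N`-th member is linear in each of the first
`N` letters. -/
def IsMultilinear (F : Type*) [Semiring F] [AddCommMonoid V] [Module F V] [AddCommMonoid W]
    [Module F W] (G : ℕ → (ℕ → V) → W) : Prop :=
  ∀ (N : ℕ) (a : ℕ → V) (i : ℕ), i < N → IsLinearMap F fun x => G N (Function.update a i x)

theorem shift_update_of_lt (a : ℕ → V) {i k : ℕ} (h : i < k) (x : V) :
    (fun j => Function.update a i x (k + j)) = fun j => a (k + j) := by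
  funext j
  rw [Function.update_of_ne (by omega)]

theorem shift_update_of_le (a : ℕ → V) {i k : ℕ} (h : k ≤ i) (x : V) :
    (fun j => Function.update a i x (k + j)) =
      Function.update (fun j => a (k + j)) (i - k) x := by
  funext j
  by_cases hj : j = i - k
  · subst hj
    rw [Function.update_self, show k + (i - k) = i by omega, Function.update_self]
  · rw [Function.update_of_ne hj, Function.update_of_ne (by omega)]

section Multilinear

variable {F : Type*} [CommSemiring F] [AddCommMonoid V] [Module F V] [AddCommMonoid W] [Module F W]

/-- A local multilinear family of maps on words as a family of multilinear maps. -/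
def toMultilinear (G : ℕ → (ℕ → V) → W) (hG : IsLocal G) (hG' : IsMultilinear F G) (k : ℕ) :
    MultilinearMap F (fun _ : Fin k => V) W :=
  MultilinearMap.mk' (fun x => G k fun i => if h : i < k then x ⟨i, h⟩ else 0)
    (by
      intro m i x y
      have e : ∀ z : V, G k (fun j => if h : j < k then Function.update m i z ⟨j, h⟩ else 0) =
          G k (Function.update (fun j => if h : j < k then m ⟨j, h⟩ else 0) i z) := by
        intro z
        refine hG _ _ _ fun j hj => ?_
        by_cases hji : j = i
        · subst hji; simp
        · rw [Function.update_of_ne hji, dif_pos hj, dif_pos hj, Function.update_of_ne]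
          intro h
          exact hji (congrArg Fin.val h)
      rw [e, e, e]
      exact (hG' k _ i i.2).map_add x y)
    (by
      intro m i c x
      have e : ∀ z : V, G k (fun j => if h : j < k then Function.update m i z ⟨j, h⟩ else 0) =
          G k (Function.update (fun j => if h : j < k then m ⟨j, h⟩ else 0) i z) := by
        intro z
        refine hG _ _ _ fun j hj => ?_
        by_cases hji : j = i
        · subst hji; simp
        · rw [Function.update_of_ne hji, dif_pos hj, dif_pos hj, Function.update_of_ne]
          intro h
          exact hji (congrArg Fin.val h)
      rw [e, e]
      exact (hG' k _ i i.2).map_smul c x)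

theorem toMultilinear_apply {G : ℕ → (ℕ → V) → W} (hG : IsLocal G) (hG' : IsMultilinear F G)
    (k : ℕ) (a : ℕ → V) : toMultilinear G hG hG' k (fun i => a i) = G k a :=
  hG _ _ _ fun i hi => by rw [dif_pos hi]

end Multilinear

end WordMap

/-! ### The sign involution of a graded vector space -/

namespace GradedSpace

variable {F : Type v} [Field F]

theorem negOnePow_smul {M : Type*} [AddCommGroup M] [Module F M] (i : ℤ) (x : M) :
    i.negOnePow • x = (((i.negOnePow : ℤˣ) : ℤ) : F) • x := by
  rw [Units.smul_def, Int.cast_smul_eq_zsmul]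

theorem homogeneous_induction (V : GradedSpace.{u, v} F) {P : V.carrier → Prop}
    (hom : ∀ i, ∀ a ∈ V.gr i, P a) (add : ∀ a b, P a → P b → P (a + b)) (a : V.carrier) : P a :=
  DirectSum.Decomposition.inductionOn V.gr (hom 0 0 (Submodule.zero_mem _))
    (fun {i} m => hom i m m.2) (fun _ _ => add _ _) a

/-- The involution which is multiplication by `(-1)^i` in degree `i`. -/
noncomputable def sign (V : GradedSpace.{u, v} F) : V.carrier →ₗ[F] V.carrier :=
  (DirectSum.toModule F ℤ V.carrier
    fun i => (((i.negOnePow : ℤˣ) : ℤ) : F) • (V.gr i).subtype).comp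
      (DirectSum.decomposeLinearEquiv V.gr).toLinearMap

theorem sign_of_mem (V : GradedSpace.{u, v} F) {i : ℤ} {a : V.carrier} (ha : a ∈ V.gr i) :
    V.sign a = i.negOnePow • a := by
  rw [negOnePow_smul (F := F)]
  change DirectSum.toModule F ℤ V.carrier _ (DirectSum.decompose V.gr a) = _
  rw [DirectSum.decompose_of_mem _ ha]
  erw [DirectSum.toModule_lof]
  rfl

theorem sign_sign (V : GradedSpace.{u, v} F) (a : V.carrier) : V.sign (V.sign a) = a := by
  induction a using V.homogeneous_induction with
  | hom i a ha =>
    rw [V.sign_of_mem ha, Units.smul_def, map_zsmul, V.sign_of_mem ha, Units.smul_def, smul_smul]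
    simp
  | add a b ha hb => rw [map_add, map_add, ha, hb]

theorem sign_map {V W : GradedSpace.{u, v} F} (L : V.carrier →ₗ[F] W.carrier) (e : ℤ)
    (hL : ∀ i, ∀ x ∈ V.gr i, L x ∈ W.gr (i + e)) (x : V.carrier) :
    W.sign (L x) = e.negOnePow • L (V.sign x) := by
  induction x using V.homogeneous_induction with
  | hom i a ha =>
    rw [V.sign_of_mem ha, W.sign_of_mem (hL i a ha), Int.negOnePow_add, Units.smul_def,
      Units.smul_def, Units.smul_def, map_zsmul, smul_smul, Units.val_mul, mul_comm]
  | add a b ha hb => simp only [map_add, ha, hb, smul_add]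

end GradedSpace

theorem GCA.sign_mul {F : Type v} [Field F] (A : GCA.{u, v} F) (a b : A.carrier) :
    A.toGradedSpace.sign (a * b) = A.toGradedSpace.sign a * A.toGradedSpace.sign b := by
  induction a using A.toGradedSpace.homogeneous_induction with
  | hom i a ha =>
    induction b using A.toGradedSpace.homogeneous_induction with
    | hom j b hb =>
      have hab : a * b ∈ A.toGradedSpace.gr (i + j) := SetLike.GradedMul.mul_mem ha hb
      rw [A.toGradedSpace.sign_of_mem hab, A.toGradedSpace.sign_of_mem ha,
        A.toGradedSpace.sign_of_mem hb, Int.negOnePow_add, Units.smul_def, Units.smul_def,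
        Units.smul_def, Units.val_mul]
      rw [smul_mul_assoc, mul_smul_comm, smul_smul]
    | add b b' hb hb' => simp only [map_add, mul_add, hb, hb']
  | add a a' ha ha' => simp only [map_add, add_mul, ha, ha']

theorem DGCA.d_mul {F : Type v} [Field F] (A : DGCA.{u, v} F) (a b : A.carrier) :
    A.d (a * b) = A.d a * b + A.toGradedSpace.sign a * A.d b := by
  induction a using A.homogeneous_induction with
  | hom i a ha =>
    rw [A.leibniz i a b ha, A.toGradedSpace.sign_of_mem ha, Units.smul_def, Units.smul_def,
      smul_mul_assoc]
  | add a a' ha ha' =>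
    rw [add_mul, map_add, ha, ha', map_add, map_add]
    noncomm_ring

/-! ### Homotopy transfer along a contraction -/

/-- A contraction of a DGCA `A` onto a graded vector space `V` with zero differential: an inclusion
of `V` as a space of cocycles, a retraction onto it, and a homotopy `h` of degree `-1` between the
identity and the projection, subject to the side conditions `h² = 0`, `h ∘ inc = 0`,
`proj ∘ h = 0`. -/
structure Contraction {F : Type v} [Field F] (A : DGCA.{u, v} F) (V : GradedSpace.{u, v} F) where
  inc : V.carrier →ₗ[F] A.carrier
  proj : A.carrier →ₗ[F] V.carrier
  h : A.carrier →ₗ[F] A.carrier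
  inc_mem : ∀ i, ∀ x ∈ V.gr i, inc x ∈ A.gr i
  proj_mem : ∀ i, ∀ a ∈ A.gr i, proj a ∈ V.gr i
  h_mem : ∀ i, ∀ a ∈ A.gr i, h a ∈ A.gr (i - 1)
  d_inc : ∀ x, A.d (inc x) = 0
  proj_inc : ∀ x, proj (inc x) = x
  h_inc : ∀ x, h (inc x) = 0
  proj_h : ∀ a, proj (h a) = 0
  h_h : ∀ a, h (h a) = 0
  d_h : ∀ a, A.d (h a) = a - inc (proj a) - h (A.d a)

namespace Contraction

variable {F : Type v} [Field F] {A : DGCA.{u, v} F} {V : GradedSpace.{u, v} F} (C : Contraction A V)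

theorem inc_injective : Function.Injective C.inc :=
  Function.LeftInverse.injective C.proj_inc

theorem proj_d (a : A.carrier) : C.proj (A.d a) = 0 := by
  apply C.inc_injective
  have h1 := C.d_h (A.d a)
  have h2 := congrArg A.d (C.d_h a)
  rw [A.d_d, map_zero, sub_zero] at h1
  rw [A.d_d, map_sub, map_sub, C.d_inc, sub_zero] at h2
  rw [map_zero]
  rw [h1] at h2
  simpa using h2.symm

theorem sign_d (a : A.carrier) :
    A.toGradedSpace.sign (A.d a) = -A.d (A.toGradedSpace.sign a) := by
  have := GradedSpace.sign_map (V := A.toGradedSpace) (W := A.toGradedSpace) A.d 1 A.d_mem a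
  simpa using this

theorem sign_h (a : A.carrier) :
    A.toGradedSpace.sign (C.h a) = -C.h (A.toGradedSpace.sign a) := by
  have := GradedSpace.sign_map (V := A.toGradedSpace) (W := A.toGradedSpace) C.h (-1)
    (fun i x hx => C.h_mem i x hx) a
  simpa using this

theorem sign_inc (x : V.carrier) : A.toGradedSpace.sign (C.inc x) = C.inc (V.sign x) := by
  have := GradedSpace.sign_map (V := V) (W := A.toGradedSpace) C.inc 0
    (fun i x hx => by simpa using C.inc_mem i x hx) x
  simpa using this

/-- The components `φ_N` of the transferred morphism with respect to the suspended (bar) sign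
conventions: `φ₁` is the inclusion and `φ_N = h(∑ ± φ_i · φ_{N-i})` for `N ≥ 2`. -/
noncomputable def phi (N : ℕ) (a : ℕ → V.carrier) : A.carrier :=
  (if N = 1 then C.inc (a 0) else 0) +
    C.h (∑ i : Finset.Ico 1 N, -A.toGradedSpace.sign (phi i a) * phi (N - i) fun j => a (i + j))
termination_by N
decreasing_by
  all_goals
    have := Finset.mem_Ico.1 i.2
    omega

/-- The sum `∑ ± φ_i · φ_{N-i}`, whose image under `h` is `φ_N`. -/
noncomputable def lam : ℕ → (ℕ → V.carrier) → A.carrier :=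
  WordMap.conv (fun i a => -A.toGradedSpace.sign (C.phi i a)) C.phi

/-- The transferred operations with respect to the suspended (bar) sign conventions. -/
noncomputable def bar (N : ℕ) (a : ℕ → V.carrier) : V.carrier := -C.proj (C.lam N a)

theorem phi_eq (N : ℕ) (a : ℕ → V.carrier) :
    C.phi N a = (if N = 1 then C.inc (a 0) else 0) + C.h (C.lam N a) := by
  rw [phi, lam, WordMap.conv, ← Finset.sum_coe_sort (Finset.Ico 1 N)]

theorem lam_of_le_one {N : ℕ} (hN : N ≤ 1) (a : ℕ → V.carrier) : C.lam N a = 0 := by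
  rw [lam, WordMap.conv, Finset.Ico_eq_empty (by omega), Finset.sum_empty]

theorem phi_one (a : ℕ → V.carrier) : C.phi 1 a = C.inc (a 0) := by
  rw [phi_eq, if_pos rfl, C.lam_of_le_one le_rfl, map_zero, add_zero]

theorem phi_zero (a : ℕ → V.carrier) : C.phi 0 a = 0 := by
  rw [phi_eq, if_neg (by omega), C.lam_of_le_one (by omega), map_zero, add_zero]

theorem phi_of_two_le {N : ℕ} (hN : 2 ≤ N) (a : ℕ → V.carrier) :
    C.phi N a = C.h (C.lam N a) := by
  rw [phi_eq, if_neg (by omega), zero_add]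

theorem phi_isLocal : WordMap.IsLocal C.phi := by
  intro N
  induction N using Nat.strong_induction_on with
  | _ N ih =>
    intro a a' haa
    rw [phi_eq, phi_eq]
    congr 1
    · split_ifs with h
      · rw [haa 0 (by omega)]
      · rfl
    · simp only [lam, WordMap.conv]
      congr 1
      refine Finset.sum_congr rfl fun i hi => ?_
      rw [Finset.mem_Ico] at hi
      congr 1
      · rw [ih i (by omega) a a' fun j hj => haa j (by omega)]
      · exact ih (N - i) (by omega) _ _ fun j hj => haa _ (by omega)

theorem lam_isLocal : WordMap.IsLocal C.lam := by
  intro N a a' haa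
  simp only [lam, WordMap.conv]
  refine Finset.sum_congr rfl fun i hi => ?_
  rw [Finset.mem_Ico] at hi
  congr 1
  · rw [C.phi_isLocal i a a' fun j hj => haa j (by omega)]
  · exact C.phi_isLocal (N - i) _ _ fun j hj => haa _ (by omega)

theorem bar_isLocal : WordMap.IsLocal C.bar := by
  intro N a a' haa
  rw [bar, bar, C.lam_isLocal N a a' haa]

theorem phi_lam_isMultilinear : WordMap.IsMultilinear F C.phi ∧ WordMap.IsMultilinear F C.lam := by
  have step : ∀ N, (∀ M < N, ∀ (a : ℕ → V.carrier) (i : ℕ), i < M →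
      IsLinearMap F fun x => C.phi M (Function.update a i x)) →
      ∀ (a : ℕ → V.carrier) (i : ℕ), i < N →
        IsLinearMap F fun x => C.lam N (Function.update a i x) := by
    intro N ih a i hi
    have key : ∀ k ∈ Finset.Ico 1 N, IsLinearMap F fun x =>
        -A.toGradedSpace.sign (C.phi k (Function.update a i x)) *
          C.phi (N - k) fun j => Function.update a i x (k + j) := by
      intro k hk
      rw [Finset.mem_Ico] at hk
      by_cases hik : i < k
      · have h := ih k hk.2 a i hik
        simp only [WordMap.shift_update_of_lt a hik]
        constructor
        · intro x y
          rw [h.map_add, map_add, neg_add, add_mul]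
        · intro c x
          rw [h.map_smul, map_smul, ← smul_neg, smul_mul_assoc]
      · have h := ih (N - k) (by omega) (fun j => a (k + j)) (i - k) (by omega)
        have e : ∀ x, C.phi k (Function.update a i x) = C.phi k a := fun x =>
          C.phi_isLocal _ _ _ fun j hj => Function.update_of_ne (by omega) _ _
        simp only [WordMap.shift_update_of_le a (not_lt.1 hik), e]
        constructor
        · intro x y
          rw [h.map_add, mul_add]
        · intro c x
          rw [h.map_smul, mul_smul_comm]
    constructor
    · intro x y
      simp only [lam, WordMap.conv]
      rw [← Finset.sum_add_distrib]
      exact Finset.sum_congr rfl fun k hk => (key k hk).map_add x y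
    · intro c x
      simp only [lam, WordMap.conv]
      rw [Finset.smul_sum]
      exact Finset.sum_congr rfl fun k hk => (key k hk).map_smul c x
  have hphi : ∀ N, ∀ (a : ℕ → V.carrier) (i : ℕ), i < N →
      IsLinearMap F fun x => C.phi N (Function.update a i x) := by
    intro N
    induction N using Nat.strong_induction_on with
    | _ N ih =>
      intro a i hi
      have h := step N ih a i hi
      simp only [phi_eq]
      by_cases hN : N = 1
      · obtain rfl : i = 0 := by omega
        subst hN
        constructor
        · intro x y
          rw [h.map_add]
          simp only [if_true, Function.update_self, map_add]
          abel
        · intro c x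
          rw [h.map_smul]
          simp only [if_true, Function.update_self, map_smul, smul_add]
      · simp only [if_neg hN, zero_add]
        exact ⟨fun x y => by rw [h.map_add, map_add], fun c x => by rw [h.map_smul, map_smul]⟩
  exact ⟨hphi, fun N => step N fun M _ => hphi M⟩

theorem bar_isMultilinear : WordMap.IsMultilinear F C.bar := by
  intro N a i hi
  have h := C.phi_lam_isMultilinear.2 N a i hi
  simp only [bar]
  exact ⟨fun x y => by rw [h.map_add, map_add, neg_add],
    fun c x => by rw [h.map_smul, map_smul, smul_neg]⟩

/-- `φ` has even total degree once the letters of a word are given their suspended degrees. -/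
theorem phi_neg_sign (N : ℕ) (a : ℕ → V.carrier) :
    C.phi N (fun j => -V.sign (a j)) = -A.toGradedSpace.sign (C.phi N a) := by
  induction N using Nat.strong_induction_on generalizing a with
  | _ N ih =>
    have hlam : C.lam N (fun j => -V.sign (a j)) = A.toGradedSpace.sign (C.lam N a) := by
      simp only [lam, WordMap.conv]
      rw [map_sum]
      refine Finset.sum_congr rfl fun i hi => ?_
      rw [Finset.mem_Ico] at hi
      rw [ih i (by omega), ih (N - i) (by omega) fun j => a (i + j), A.sign_mul, map_neg,
        A.toGradedSpace.sign_sign]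
      noncomm_ring
    rw [phi_eq, phi_eq, hlam, map_add, C.sign_h]
    split_ifs
    · rw [map_neg, C.sign_inc]
      abel
    · rw [map_zero]
      abel

theorem d_lam_eq_conv (N : ℕ) (a : ℕ → V.carrier) :
    A.d (C.lam N a) =
      WordMap.conv (fun i c => -A.toGradedSpace.sign (-A.d (C.phi i c))) C.phi N a +
        WordMap.conv C.phi (fun i c => -A.d (C.phi i c)) N a := by
  simp only [lam, WordMap.conv]
  rw [map_sum, ← Finset.sum_add_distrib]
  refine Finset.sum_congr rfl fun i _ => ?_
  rw [A.d_mul, map_neg, map_neg, map_neg, sign_d, A.toGradedSpace.sign_sign]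
  noncomm_ring

theorem insertion_lam (N : ℕ) (a : ℕ → V.carrier) :
    WordMap.insertion (fun x => -V.sign x) C.bar C.lam N a =
      WordMap.conv (fun i c => -A.toGradedSpace.sign
          (WordMap.insertion (fun x => -V.sign x) C.bar C.phi i c)) C.phi N a +
        WordMap.conv C.phi (WordMap.insertion (fun x => -V.sign x) C.bar C.phi) N a := by
  have h := WordMap.insertion_conv (fun x => -V.sign x) C.bar
    (G := fun i a => -A.toGradedSpace.sign (C.phi i a)) (K := C.phi)
    (fun N a a' h => by simp only [C.phi_isLocal N a a' h]) N a
  rw [lam, h]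
  congr 1
  · refine Finset.sum_congr rfl fun i _ => ?_
    congr 1
    simp only [WordMap.insertion, map_sum, Finset.sum_neg_distrib]
  · refine Finset.sum_congr rfl fun i _ => ?_
    congr 1
    simp only [phi_neg_sign, map_neg, A.toGradedSpace.sign_sign, neg_neg]

/-- Associativity of the product of `A`. -/
theorem conv_lam_phi (N : ℕ) (a : ℕ → V.carrier) :
    WordMap.conv (fun i c => -A.toGradedSpace.sign (C.lam i c)) C.phi N a +
      WordMap.conv C.phi C.lam N a = 0 := by
  have h : (fun i c => -A.toGradedSpace.sign (C.lam i c)) =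
      fun i c => -WordMap.conv C.phi (fun i a => -A.toGradedSpace.sign (C.phi i a)) i c := by
    funext i c
    simp only [lam, WordMap.conv, map_sum]
    congr 1
    refine Finset.sum_congr rfl fun j _ => ?_
    rw [A.sign_mul, map_neg, A.toGradedSpace.sign_sign]
    noncomm_ring
  have h2 : WordMap.conv (fun i c =>
      -WordMap.conv C.phi (fun i a => -A.toGradedSpace.sign (C.phi i a)) i c) C.phi N a =
      -WordMap.conv (WordMap.conv C.phi (fun i a => -A.toGradedSpace.sign (C.phi i a)))
        C.phi N a := by
    conv_lhs => rw [WordMap.conv]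
    conv_rhs => rw [WordMap.conv]
    simp only [neg_mul, Finset.sum_neg_distrib]
  rw [h, h2, WordMap.conv_assoc, lam, neg_add_cancel]

theorem insertion_phi {N : ℕ} (hN : 1 ≤ N) (a : ℕ → V.carrier) :
    WordMap.insertion (fun x => -V.sign x) C.bar C.phi N a =
      C.inc (C.bar N a) + C.h (WordMap.insertion (fun x => -V.sign x) C.bar C.lam N a) := by
  simp only [WordMap.insertion, map_sum]
  rw [Finset.sum_congr rfl fun r _ => Finset.sum_congr rfl fun s _ => C.phi_eq _ _]
  simp only [Finset.sum_add_distrib]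
  congr 1
  -- `φ₁` occurs only when `b` is applied to the whole word.
  rw [Finset.sum_eq_single_of_mem 0 (by simp; omega),
    Finset.sum_eq_single_of_mem N (by simp; omega)]
  · rw [if_pos (by omega), WordMap.insertSeq_self]
    simp only [zero_add]
  · intro s hs hsN
    rw [Finset.mem_Icc] at hs
    rw [if_neg (by omega)]
  · intro r hr hr0
    exact Finset.sum_eq_zero fun s _ => if_neg (by omega)

/-- As `λ_N` involves only the `φ_M` with `M < N`, its differential is determined by the morphism
equation in lower arities. -/
theorem d_lam_of_d_phi {N : ℕ}
    (ih : ∀ M < N, ∀ a, A.d (C.phi M a) =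
      WordMap.insertion (fun x => -V.sign x) C.bar C.phi M a + C.lam M a) (a : ℕ → V.carrier) :
    A.d (C.lam N a) = -WordMap.insertion (fun x => -V.sign x) C.bar C.lam N a := by
  rw [eq_neg_iff_add_eq_zero, d_lam_eq_conv, insertion_lam, ← neg_eq_zero, ← C.conv_lam_phi N a]
  simp only [WordMap.conv]
  rw [← Finset.sum_add_distrib, ← Finset.sum_add_distrib, ← Finset.sum_add_distrib,
    ← Finset.sum_add_distrib, ← Finset.sum_neg_distrib]
  refine Finset.sum_congr rfl fun i hi => ?_
  rw [Finset.mem_Ico] at hi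
  rw [ih i (by omega), ih (N - i) (by omega)]
  simp only [map_neg, map_add]
  noncomm_ring

/-- The equation of an `A_∞`-morphism. The Stasheff identities for the transferred operations are
not needed in the induction but follow from it. -/
theorem d_phi (N : ℕ) (a : ℕ → V.carrier) :
    A.d (C.phi N a) = WordMap.insertion (fun x => -V.sign x) C.bar C.phi N a + C.lam N a := by
  induction N using Nat.strong_induction_on generalizing a with
  | _ N ih =>
    rcases Nat.eq_zero_or_pos N with rfl | hN
    · rw [phi_zero, C.lam_of_le_one (by omega)]
      simp [WordMap.insertion]
    · rw [insertion_phi C hN, phi_eq, map_add, C.d_h, C.d_lam_of_d_phi ih, bar, map_neg, map_neg]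
      have : A.d (if N = 1 then C.inc (a 0) else 0) = 0 := by
        split_ifs
        · exact C.d_inc _
        · exact map_zero _
      rw [this]
      abel

theorem d_lam (N : ℕ) (a : ℕ → V.carrier) :
    A.d (C.lam N a) = -WordMap.insertion (fun x => -V.sign x) C.bar C.lam N a :=
  C.d_lam_of_d_phi (fun M _ => C.d_phi M) a

theorem proj_phi (N : ℕ) (a : ℕ → V.carrier) : C.proj (C.phi N a) = if N = 1 then a 0 else 0 := by
  rw [phi_eq, map_add, C.proj_h, add_zero]
  split_ifs
  · exact C.proj_inc _
  · exact map_zero _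

/-- The Stasheff identities with respect to the suspended sign conventions. -/
theorem insertion_bar (N : ℕ) (a : ℕ → V.carrier) :
    WordMap.insertion (fun x => -V.sign x) C.bar C.bar N a = 0 := by
  -- Since `φ ∘ b = d φ - λ` and `λ ∘ b = -d λ`, the composite `φ ∘ b ∘ b` vanishes.
  have h1 : WordMap.insertion (fun x => -V.sign x) C.bar
      (WordMap.insertion (fun x => -V.sign x) C.bar C.phi) N a = 0 := by
    have e : WordMap.insertion (fun x => -V.sign x) C.bar C.phi =
        fun M c => A.d (C.phi M c) - C.lam M c := by
      funext M c
      rw [d_phi, add_sub_cancel_right]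
    have e2 : WordMap.insertion (fun x => -V.sign x) C.bar
        (fun M c => A.d (C.phi M c) - C.lam M c) N a =
        A.d (WordMap.insertion (fun x => -V.sign x) C.bar C.phi N a) -
          WordMap.insertion (fun x => -V.sign x) C.bar C.lam N a := by
      conv_lhs => rw [WordMap.insertion]
      simp only [Finset.sum_sub_distrib]
      simp only [WordMap.insertion, map_sum]
    rw [e, e2, e, map_sub, A.d_d, C.d_lam]
    abel
  have h2 : ∀ M, 1 ≤ M → ∀ c, C.proj (WordMap.insertion (fun x => -V.sign x) C.bar C.phi M c) =
      C.bar M c := by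
    intro M hM c
    rw [C.insertion_phi hM, map_add, C.proj_h, C.proj_inc, add_zero]
  have h3 := congrArg C.proj h1
  rw [map_zero, WordMap.insertion] at h3
  simp only [map_sum] at h3
  rw [← h3, WordMap.insertion]
  exact Finset.sum_congr rfl fun r _ => Finset.sum_congr rfl fun s _ => (h2 _ (by omega) _).symm

end Contraction

/-! ### From suspended to unsuspended sign conventions -/

section Unsuspend

variable {F : Type v} [Field F] {V W : GradedSpace.{u, v} F}

/-- The exponent `∑ (k-1-i) p_i` of the sign relating suspended and unsuspended operations. -/
def unsuspendExponent (k : ℕ) (p : ℕ → ℤ) : ℤ := ∑ i ∈ Finset.range k, ((k : ℤ) - 1 - i) * p i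

/-- The family of multilinear maps `(a₀, …, a_{k-1}) ↦ ± G_k(a₀, …, a_{k-1})` with the sign
`∑ (k-1-i) |a_i|`. -/
noncomputable def unsuspend (G : ℕ → (ℕ → V.carrier) → W.carrier) (hG : WordMap.IsLocal G)
    (hG' : WordMap.IsMultilinear F G) (k : ℕ) : KLinear V W k :=
  (WordMap.toMultilinear G hG hG' k).compLinearMap fun i => V.sign ^ (k - 1 - (i : ℕ))

theorem cast_negOnePow_sum (c : ℕ → ℤ) (N : ℕ) :
    (((∑ i ∈ Finset.range N, c i).negOnePow : ℤ) : F) =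
      ∏ i : Fin N, (((c i).negOnePow : ℤ) : F) := by
  rw [Finset.prod_fin_eq_prod_range]
  induction N with
  | zero => simp
  | succ N ih =>
    rw [Finset.sum_range_succ, Int.negOnePow_add, Finset.prod_range_succ, Units.val_mul,
      Int.cast_mul, ih, dif_pos (Nat.lt_succ_self N)]
    congr 1
    refine Finset.prod_congr rfl fun i hi => ?_
    rw [Finset.mem_range] at hi
    rw [dif_pos hi, dif_pos (by omega)]

/-- Multilinearity with respect to signs. -/
theorem WordMap.map_negOnePow_smul {G : ℕ → (ℕ → V.carrier) → W.carrier}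
    (hG : WordMap.IsLocal G) (hG' : WordMap.IsMultilinear F G) (N : ℕ) (c : ℕ → ℤ)
    {a a' : ℕ → V.carrier} (h : ∀ i < N, a' i = (c i).negOnePow • a i) :
    G N a' = (∑ i ∈ Finset.range N, c i).negOnePow • G N a := by
  rw [hG N a' _ h, GradedSpace.negOnePow_smul (F := F), cast_negOnePow_sum,
    ← WordMap.toMultilinear_apply hG hG', ← WordMap.toMultilinear_apply hG hG',
    ← MultilinearMap.map_smul_univ]
  simp only [GradedSpace.negOnePow_smul (F := F)]

theorem GradedSpace.sign_pow_of_mem {i : ℤ} {a : V.carrier} (ha : a ∈ V.gr i) (k : ℕ) :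
    (V.sign ^ k) a = (k * i).negOnePow • a := by
  induction k with
  | zero => simp
  | succ k ih =>
    rw [pow_succ', Module.End.mul_apply, ih, Units.smul_def, map_zsmul, V.sign_of_mem ha,
      Units.smul_def, smul_smul, Units.smul_def, ← Units.val_mul, ← Int.negOnePow_add]
    congr 4
    push_cast
    ring

theorem unsuspend_apply {G : ℕ → (ℕ → V.carrier) → W.carrier} (hG : WordMap.IsLocal G)
    (hG' : WordMap.IsMultilinear F G) (k : ℕ) {p : ℕ → ℤ} {a : ℕ → V.carrier}
    (ha : ∀ i, a i ∈ V.gr (p i)) :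
    unsuspend G hG hG' k (fun i => a i) = (unsuspendExponent k p).negOnePow • G k a := by
  rw [unsuspend, MultilinearMap.compLinearMap_apply]
  rw [WordMap.toMultilinear_apply hG hG' k fun i => (V.sign ^ (k - 1 - i)) (a i)]
  refine WordMap.map_negOnePow_smul hG hG' k _ fun i hi => ?_
  rw [GradedSpace.sign_pow_of_mem (ha i)]
  congr 3
  omega

theorem negOnePow_smul_mem {i : ℤ} {x : W.carrier} (k : ℤ) (hx : x ∈ W.gr i) :
    k.negOnePow • x ∈ W.gr i := by
  rw [Units.smul_def]
  exact zsmul_mem hx _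

theorem unsuspend_hasDegree {G : ℕ → (ℕ → V.carrier) → W.carrier} (hG : WordMap.IsLocal G)
    (hG' : WordMap.IsMultilinear F G) {e : ℤ}
    (h : ∀ (k : ℕ) (p : ℕ → ℤ) (a : ℕ → V.carrier), (∀ i, a i ∈ V.gr (p i)) →
      G k a ∈ W.gr (∑ i ∈ Finset.range k, p i + e - k)) :
    HasDegree (unsuspend G hG hG') e := by
  intro k p a ha
  rw [unsuspend_apply hG hG' k ha]
  exact negOnePow_smul_mem _ (h k p a ha)

theorem unsuspendExponent_add (i j : ℕ) (p : ℕ → ℤ) :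
    unsuspendExponent (i + j) p = unsuspendExponent i p + j * ∑ l ∈ Finset.range i, p l +
      unsuspendExponent j fun l => p (i + l) := by
  simp only [unsuspendExponent]
  rw [Finset.sum_range_add, Finset.mul_sum, ← Finset.sum_add_distrib]
  congr 1
  · refine Finset.sum_congr rfl fun l _ => ?_
    push_cast
    ring
  · refine Finset.sum_congr rfl fun l _ => ?_
    push_cast
    ring

/-- In terms of the suspended operations, the Koszul signs of `insertionSum` are those of letters of
degree `p_i - 1`. -/
theorem insertionSum_unsuspend {G : ℕ → (ℕ → V.carrier) → W.carrier}
    {b : ℕ → (ℕ → V.carrier) → V.carrier} (hG : WordMap.IsLocal G)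
    (hG' : WordMap.IsMultilinear F G) (hb : WordMap.IsLocal b) (hb' : WordMap.IsMultilinear F b)
    (hdeg : ∀ (k : ℕ) (p : ℕ → ℤ) (a : ℕ → V.carrier), (∀ i, a i ∈ V.gr (p i)) →
      b k a ∈ V.gr (∑ i ∈ Finset.range k, p i + 2 - k))
    (N : ℕ) (p : ℕ → ℤ) (a : ℕ → V.carrier) (ha : ∀ i, a i ∈ V.gr (p i)) :
    insertionSum (unsuspend G hG hG') (unsuspend b hb hb') N p a =
      (unsuspendExponent N p).negOnePow • WordMap.insertion (fun x => -V.sign x) b G N a := by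
  rw [insertionSum, WordMap.insertion, Units.smul_def, Finset.smul_sum]
  refine Finset.sum_congr rfl fun r hr => ?_
  rw [Finset.smul_sum]
  refine Finset.sum_congr rfl fun s hs => ?_
  rw [Finset.mem_range] at hr
  rw [Finset.mem_Icc] at hs
  obtain ⟨t, rfl⟩ : ∃ t, N = r + (s + t) := ⟨N - r - s, by omega⟩
  have ht : r + (s + t) - r - s = t := by omega
  rw [ht]
  have har : ∀ j, a (r + j) ∈ V.gr (p (r + j)) := fun j => ha _
  rw [unsuspend_apply hb hb' s har]
  set x := b s fun j => a (r + j) with hx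
  have hxmem := hdeg s (fun j => p (r + j)) (fun j => a (r + j)) har
  set q : ℤ := ∑ j ∈ Finset.range s, p (r + j) + 2 - s with hq
  set e : ℤ := unsuspendExponent s fun j => p (r + j) with he
  have hmem : ∀ i, spliceSeq a r s (e.negOnePow • x) i ∈ V.gr (spliceSeq p r s q i) := by
    intro i
    unfold spliceSeq
    split_ifs
    · exact ha _
    · exact negOnePow_smul_mem _ hxmem
    · exact ha _
  rw [unsuspend_apply hG hG' _ hmem]
  have hsign : ∀ i < r + 1 + t, spliceSeq a r s (e.negOnePow • x) i =
      (if i < r then p i - 1 else if i = r then e else 0).negOnePow •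
        WordMap.insertSeq (fun x => -V.sign x) b a r s i := by
    intro i _
    rcases lt_trichotomy i r with hi | hi | hi
    · rw [WordMap.insertSeq_of_lt hi, if_pos hi, V.sign_of_mem (ha i)]
      simp only [spliceSeq, if_pos hi]
      rw [Int.negOnePow_sub, Units.smul_def, Units.smul_def, smul_neg, smul_smul]
      simp
    · subst hi
      rw [WordMap.insertSeq_self, if_neg (lt_irrefl _), if_pos rfl]
      simp [spliceSeq, hx]
    · rw [WordMap.insertSeq_of_gt hs.1 hi, if_neg (by omega), if_neg (by omega)]
      simp only [spliceSeq]
      rw [if_neg (by omega), if_neg (by omega)]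
      simp
  rw [WordMap.map_negOnePow_smul hG hG' _ _ hsign, smul_smul, smul_smul, ← Int.negOnePow_add,
    ← Int.negOnePow_add, Units.smul_def]
  congr 2
  rw [Int.negOnePow_eq_iff]
  have h1 : ∑ i ∈ Finset.range (r + 1 + t), (if i < r then p i - 1 else if i = r then e else 0) =
      ∑ i ∈ Finset.range r, p i - r + e := by
    rw [Finset.sum_range_add, Finset.sum_range_succ, if_neg (lt_irrefl _), if_pos rfl,
      Finset.sum_congr rfl fun i hi => if_pos (Finset.mem_range.1 hi),
      Finset.sum_eq_zero (s := Finset.range t) fun i _ => by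
        rw [if_neg (by omega), if_neg (by omega)]]
    simp
  have h2 : unsuspendExponent (r + 1 + t) (spliceSeq p r s q) =
      unsuspendExponent r p + (1 + t) * ∑ i ∈ Finset.range r, p i + t * q +
        unsuspendExponent t fun j => p (r + (s + j)) := by
    have e1 : unsuspendExponent r (spliceSeq p r s q) = unsuspendExponent r p :=
      Finset.sum_congr rfl fun i hi => by simp [spliceSeq, Finset.mem_range.1 hi]
    have e2 : ∑ i ∈ Finset.range r, spliceSeq p r s q i = ∑ i ∈ Finset.range r, p i :=
      Finset.sum_congr rfl fun i hi => by simp [spliceSeq, Finset.mem_range.1 hi]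
    have e3 : (fun l => spliceSeq p r s q (r + (1 + l))) = fun l => p (r + (s + l)) := by
      funext l
      unfold spliceSeq
      rw [if_neg (by omega), if_neg (by omega)]
      congr 1
      omega
    rw [add_assoc, unsuspendExponent_add, unsuspendExponent_add, e1, e2, e3]
    simp [unsuspendExponent, spliceSeq]
    ring
  rw [h1, h2, unsuspendExponent_add, unsuspendExponent_add, ← he, hq]
  refine ⟨(2 - s) * ∑ i ∈ Finset.range r, p i + t, ?_⟩
  push_cast
  ring

end Unsuspend

/-- Only the compositions into one and two blocks contribute, as a DGCA has no operations of arity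
greater than `2`. -/
theorem DGCA.compositionSum_ops {F : Type v} [Field F] (A : DGCA.{u, v} F)
    {V : GradedSpace.{u, v} F} (f : ∀ k, KLinear V A.toGradedSpace k) {N : ℕ} (hN : 1 ≤ N)
    (p : ℕ → ℤ) (a : ℕ → V.carrier) :
    compositionSum A.ops f N p a = A.d (f N fun i => a i) +
      ∑ i ∈ Finset.Ico 1 N,
        ((i : ℤ) - 1 + (1 - ((N - i : ℕ) : ℤ)) * ∑ j ∈ Finset.range i, p j).negOnePow •
          ((f i fun j => a j : A.carrier) * f (N - i) fun j => a (i + j) : A.carrier) := by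
  have hd : ∀ w : Fin 1 → A.carrier, A.ops 1 w = A.d (w 0) := by
    intro w
    change A.d (MultilinearMap.mkPiAlgebraFin F 1 A.carrier w) = A.d (w 0)
    rw [MultilinearMap.mkPiAlgebraFin_apply]
    simp
  have hmul : ∀ w : Fin 2 → A.carrier, A.ops 2 w = w 0 * w 1 := by
    intro w
    change (MultilinearMap.mkPiAlgebraFin F 2 A.carrier w) = w 0 * w 1
    rw [MultilinearMap.mkPiAlgebraFin_apply]
    simp
  have hzero : ∀ (l : ℕ) (w : Fin l → A.carrier), l ≠ 1 → l ≠ 2 → A.ops l w = 0 := by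
    intro l w h1 h2
    match l, h1, h2 with
    | 0, _, _ => rfl
    | l + 3, _, _ => rfl
  let T : Composition N → A.carrier := fun c =>
    (∑ k : Fin c.length, (((c.length : ℤ) - 1 - (k : ℕ)) * ((c.blocksFun k : ℤ) - 1) +
      (1 - (c.blocksFun k : ℤ)) * ∑ i ∈ Finset.range (c.sizeUpTo k), p i)).negOnePow •
      A.ops c.length fun k => f (c.blocksFun k) fun x => a (c.sizeUpTo k + x)
  have hT1 : ∀ c : Composition N, c.blocks = [N] → T c = A.d (f N fun i => a i) := by
    rintro ⟨_, hp, hs⟩ rfl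
    refine Eq.trans (b := (0 : ℤ).negOnePow • A.ops 1 fun _ : Fin 1 => f N fun x => a (0 + x)) ?_ ?_
    · refine congrArg₂ (fun (z : ℤ) (w : Fin 1 → A.carrier) => z.negOnePow • A.ops 1 w) ?_
        (funext fun k => ?_)
      · refine (Fin.sum_univ_one _).trans ?_
        change (((1 : ℕ) : ℤ) - 1 - ((0 : ℕ) : ℤ)) * ((N : ℤ) - 1) +
          (1 - (N : ℤ)) * ∑ i ∈ Finset.range 0, p i = 0
        simp
      · match k with
        | 0 => rfl
    · rw [hd]
      simp
  have hT2 : ∀ (c : Composition N) (i : ℕ), c.blocks = [i, N - i] → T c =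
      ((i : ℤ) - 1 + (1 - ((N - i : ℕ) : ℤ)) * ∑ j ∈ Finset.range i, p j).negOnePow •
          ((f i fun j => a j : A.carrier) * f (N - i) fun j => a (i + j) : A.carrier) := by
    rintro ⟨_, hp, hs⟩ i rfl
    refine Eq.trans (b := ((i : ℤ) - 1 + (1 - ((N - i : ℕ) : ℤ)) *
      ∑ j ∈ Finset.range i, p j).negOnePow • A.ops 2 ![f i fun x => a (0 + x),
        f (N - i) fun x => a (i + x)]) ?_ ?_
    · refine congrArg₂ (fun (z : ℤ) (w : Fin 2 → A.carrier) => z.negOnePow • A.ops 2 w) ?_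
        (funext fun k => ?_)
      · refine (Fin.sum_univ_two _).trans ?_
        change ((((2 : ℕ) : ℤ) - 1 - ((0 : ℕ) : ℤ)) * ((i : ℤ) - 1) +
          (1 - (i : ℤ)) * ∑ i ∈ Finset.range 0, p i) +
          ((((2 : ℕ) : ℤ) - 1 - ((1 : ℕ) : ℤ)) * (((N - i : ℕ) : ℤ) - 1) +
          (1 - ((N - i : ℕ) : ℤ)) * ∑ i ∈ Finset.range i, p i) = _
        simp
      · match k with
        | 0 => rfl
        | 1 => rfl
    · rw [hmul]
      simp
  change ∑ c : Composition N, T c = _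
  rw [← Finset.sum_filter_add_sum_filter_not _ (fun c => c.length = 1)]
  congr 1
  · have h : (Finset.univ.filter fun c : Composition N => c.length = 1) =
        {Composition.single N hN} := by
      ext c
      simp [Composition.eq_single_iff_length]
    rw [h, Finset.sum_singleton, hT1 _ rfl]
  · rw [← Finset.sum_filter_of_ne (p := fun c : Composition N => c.length = 2)]
    · symm
      refine Finset.sum_bij (fun i hi => ⟨[i, N - i], ?_, ?_⟩) ?_ ?_ ?_ ?_
      · intro j hj
        rw [Finset.mem_Ico] at hi
        simp only [List.mem_cons, List.not_mem_nil, or_false] at hj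
        omega
      · rw [Finset.mem_Ico] at hi
        simp only [List.sum_cons, List.sum_nil]
        omega
      · intro i hi
        simp [Composition.length]
      · intro i hi j hj hij
        have := congrArg Composition.blocks hij
        simp only [List.cons.injEq] at this
        exact this.1
      · intro c hc
        simp only [Finset.mem_filter, Finset.mem_univ, true_and] at hc
        obtain ⟨i, j, hij⟩ := List.length_eq_two.1 hc.2
        have hs := c.blocks_sum
        have hi : 0 < i := c.blocks_pos (by simp [hij])
        have hj : 0 < j := c.blocks_pos (by simp [hij])
        simp only [hij, List.sum_cons, List.sum_nil] at hs
        refine ⟨i, Finset.mem_Ico.2 (by omega), Composition.ext ?_⟩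
        change [i, N - i] = c.blocks
        rw [hij, show N - i = j by omega]
      · intro i hi
        exact (hT2 _ i rfl).symm
    · intro c hc h
      by_contra h2
      refine h ?_
      simp only [Finset.mem_filter, Finset.mem_univ, true_and] at hc
      simp only [T]
      rw [hzero _ _ hc h2, smul_zero]

/-! ### The transferred structure -/

namespace Contraction

variable {F : Type v} [Field F] {A : DGCA.{u, v} F} {V : GradedSpace.{u, v} F} (C : Contraction A V)

theorem lam_mem_of_phi_mem {N : ℕ} (p : ℕ → ℤ)
    (ih : ∀ M < N, ∀ (p : ℕ → ℤ) (a : ℕ → V.carrier), (∀ i, a i ∈ V.gr (p i)) →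
      C.phi M a ∈ A.gr (∑ i ∈ Finset.range M, p i + 1 - M))
    {a : ℕ → V.carrier} (ha : ∀ i, a i ∈ V.gr (p i)) :
    C.lam N a ∈ A.gr (∑ i ∈ Finset.range N, p i + 2 - N) := by
  rw [lam, WordMap.conv]
  refine Submodule.sum_mem _ fun i hi => ?_
  rw [Finset.mem_Ico] at hi
  have h1 := ih i (by omega) p a ha
  have h2 := ih (N - i) (by omega) (fun j => p (i + j)) (fun j => a (i + j)) fun j => ha _
  have h3 : -A.toGradedSpace.sign (C.phi i a) ∈ A.gr (∑ i ∈ Finset.range i, p i + 1 - i) := by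
    rw [A.toGradedSpace.sign_of_mem h1]
    exact neg_mem (negOnePow_smul_mem (W := A.toGradedSpace) _ h1)
  have h4 : ∑ j ∈ Finset.range N, p j =
      ∑ j ∈ Finset.range i, p j + ∑ j ∈ Finset.range (N - i), p (i + j) := by
    rw [← Finset.sum_range_add, Nat.add_sub_cancel' (by omega)]
  have h5 := SetLike.GradedMul.mul_mem h3 h2
  convert! h5 using 2
  rw [h4]
  push_cast [show i ≤ N by omega]
  ring

theorem phi_mem (N : ℕ) (p : ℕ → ℤ) (a : ℕ → V.carrier) (ha : ∀ i, a i ∈ V.gr (p i)) :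
    C.phi N a ∈ A.gr (∑ i ∈ Finset.range N, p i + 1 - N) := by
  induction N using Nat.strong_induction_on generalizing p a with
  | _ N ih =>
    rw [phi_eq]
    refine add_mem ?_ ?_
    · split_ifs with h
      · subst h
        simpa using C.inc_mem _ _ (ha 0)
      · exact zero_mem _
    · have := C.h_mem _ _ (C.lam_mem_of_phi_mem p ih ha)
      convert this using 2
      ring

theorem lam_mem (N : ℕ) (p : ℕ → ℤ) (a : ℕ → V.carrier) (ha : ∀ i, a i ∈ V.gr (p i)) :
    C.lam N a ∈ A.gr (∑ i ∈ Finset.range N, p i + 2 - N) :=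
  C.lam_mem_of_phi_mem p (fun M _ => C.phi_mem M) ha

theorem bar_mem (N : ℕ) (p : ℕ → ℤ) (a : ℕ → V.carrier) (ha : ∀ i, a i ∈ V.gr (p i)) :
    C.bar N a ∈ V.gr (∑ i ∈ Finset.range N, p i + 2 - N) :=
  neg_mem (C.proj_mem _ _ (C.lam_mem N p a ha))

theorem bar_of_le_one {N : ℕ} (hN : N ≤ 1) (a : ℕ → V.carrier) : C.bar N a = 0 := by
  rw [bar, C.lam_of_le_one hN, map_zero, neg_zero]

/-- The `A_∞`-structure on `V` obtained by homotopy transfer. -/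
noncomputable def transfer : AInfinityStructure V where
  m := unsuspend C.bar C.bar_isLocal C.bar_isMultilinear
  m_zero := by
    ext x
    exact C.bar_of_le_one (by omega) _
  degree := unsuspend_hasDegree _ _ C.bar_mem
  stasheff N _ p a ha := by
    rw [insertionSum_unsuspend _ _ _ _ C.bar_mem N p a ha, C.insertion_bar, smul_zero]

/-- The `A_∞`-morphism from the transferred structure on `V` to `A`. -/
noncomputable def transferHom : AInfinityHom C.transfer A.toAInfinity where
  f := unsuspend C.phi C.phi_isLocal C.phi_lam_isMultilinear.1
  f_zero := by
    ext x
    exact C.phi_zero _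
  degree := unsuspend_hasDegree _ _ C.phi_mem
  compat N hN p a ha := by
    have h := A.compositionSum_ops
      (unsuspend C.phi C.phi_isLocal C.phi_lam_isMultilinear.1) hN p a
    refine Eq.trans ?_ h.symm
    refine (insertionSum_unsuspend _ _ _ _ C.bar_mem N p a ha).trans ?_
    rw [eq_sub_of_add_eq (C.d_phi N a).symm, smul_sub, sub_eq_add_neg]
    congr 1
    · rw [unsuspend_apply _ _ N ha, Units.smul_def, Units.smul_def, map_zsmul]
    · have hlam : C.lam N a = ∑ i ∈ Finset.Ico 1 N, -A.toGradedSpace.sign (C.phi i a) *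
          C.phi (N - i) fun j => a (i + j) := rfl
      rw [hlam, Units.smul_def, Finset.smul_sum, ← Finset.sum_neg_distrib]
      refine Finset.sum_congr rfl fun i hi => ?_
      rw [Finset.mem_Ico] at hi
      obtain ⟨j, rfl⟩ : ∃ j, N = i + j := ⟨N - i, by omega⟩
      rw [Nat.add_sub_cancel_left, unsuspend_apply _ _ i ha,
        unsuspend_apply (p := fun l => p (i + l)) (a := fun l => a (i + l)) _ _ j fun l => ha _,
        A.toGradedSpace.sign_of_mem (C.phi_mem i p a ha), neg_mul, smul_neg, neg_neg]
      simp only [Units.smul_def]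
      rw [smul_mul_assoc, smul_mul_assoc, mul_smul_comm, smul_smul, smul_smul, smul_smul,
        ← Units.val_mul, ← Units.val_mul, ← Units.val_mul, ← Int.negOnePow_add,
        ← Int.negOnePow_add, ← Int.negOnePow_add]
      congr 2
      rw [Int.negOnePow_eq_iff, unsuspendExponent_add]
      refine ⟨j * ∑ l ∈ Finset.range i, p l - i + 1, ?_⟩
      ring

theorem transfer_one : C.transfer.m 1 = 0 := by
  ext x
  exact C.bar_of_le_one (by omega) _

theorem transferHom_linear_apply (x : V.carrier) :
    ((C.transferHom.f 1).linear x : A.carrier) = C.inc x := by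
  change unsuspend (W := A.toGradedSpace) C.phi C.phi_isLocal C.phi_lam_isMultilinear.1 1
    (fun _ => x) = C.inc x
  rw [unsuspend, MultilinearMap.compLinearMap_apply]
  have e : (fun i : Fin 1 => (V.sign ^ (1 - 1 - (i : ℕ))) x) = fun _ => x := by
    funext i
    simp
  rw [e]
  refine (WordMap.toMultilinear_apply C.phi_isLocal C.phi_lam_isMultilinear.1 1 fun _ => x).trans ?_
  exact C.phi_one _

theorem transferHom_isQuasiIso : C.transferHom.IsQuasiIso := by
  have hd : ∀ a, (A.toAInfinity.m 1).linear a = A.d a := fun a => A.ops_apply 1 fun _ => a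
  have hm : ∀ x, (C.transfer.m 1).linear x = 0 := by
    intro x
    rw [transfer_one]
    rfl
  constructor
  · intro x
    rw [hm, map_zero]
    exact ((hd _).trans ((congrArg A.d (C.transferHom_linear_apply x)).trans (C.d_inc x))).symm
  · rintro x - ⟨y, hy⟩
    rw [hd, transferHom_linear_apply] at hy
    refine ⟨0, ?_⟩
    rw [map_zero, ← C.proj_inc x, ← hy, C.proj_d]
  · intro y hy
    rw [hd] at hy
    refine ⟨C.proj y, hm _, C.h y, ?_⟩
    rw [hd, transferHom_linear_apply, C.d_h, hy, map_zero, sub_zero]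

end Contraction

/-! ### The contraction of a Hodge type decomposition -/

namespace PoincareDGCA.HodgeDecomposition

variable {F : Type v} [Field F] {n : ℕ} {A : PoincareDGCA.{u, v} F n} (D : A.HodgeDecomposition)

theorem d_harmonic {x : A.carrier} (hx : x ∈ D.harmonic) : A.d x = 0 := by
  have h : x ∈ LinearMap.ker A.d := D.isHarmonic.span ▸ Submodule.mem_sup_left hx
  exact h

theorem eq_zero_of_add_eq_zero {x y z : A.carrier} (hx : x ∈ LinearMap.range A.d)
    (hy : y ∈ D.harmonic) (hz : z ∈ D.coexact) (h : x + y + z = 0) : x = 0 ∧ y = 0 ∧ z = 0 := by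
  have hind := D.isInternal.submodule_iSupIndep
  have h0 := Submodule.disjoint_def.1 (hind 0) x hx
    (by
      rw [show x = -(y + z) by rw [eq_neg_iff_add_eq_zero, ← h]; abel]
      refine neg_mem (add_mem ?_ ?_)
      · exact Submodule.mem_iSup_of_mem 1 (Submodule.mem_iSup_of_mem (by decide) hy)
      · exact Submodule.mem_iSup_of_mem 2 (Submodule.mem_iSup_of_mem (by decide) hz))
  rw [h0, zero_add] at h
  have h1 := Submodule.disjoint_def.1 (hind 1) y hy
    (by
      rw [eq_neg_of_add_eq_zero_left h]
      exact neg_mem (Submodule.mem_iSup_of_mem 2 (Submodule.mem_iSup_of_mem (by decide) hz)))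
  rw [h1, zero_add] at h
  exact ⟨h0, h1, h⟩

theorem eq_zero_of_d_eq_zero {b : A.carrier} (hb : b ∈ D.coexact) (h : A.d b = 0) : b = 0 := by
  have hk : b ∈ D.harmonic ⊔ LinearMap.range A.d := by
    rw [D.isHarmonic.span]
    exact h
  obtain ⟨y, hy, x, hx, rfl⟩ := Submodule.mem_sup.1 hk
  have := (D.eq_zero_of_add_eq_zero (neg_mem hx) (neg_mem hy) hb (by abel)).2.2
  exact this

/-- The parametrization `(b, x, b') ↦ d b + x + b'` of `A` by `ℬ × ℋ × ℬ`. -/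
def param : (D.coexact × D.harmonic × D.coexact) →ₗ[F] A.carrier :=
  (A.d ∘ₗ D.coexact.subtype).coprod (D.harmonic.subtype.coprod D.coexact.subtype)

theorem param_apply (b : D.coexact) (x : D.harmonic) (b' : D.coexact) :
    D.param (b, x, b') = A.d b + (x + b') := rfl

theorem param_bijective : Function.Bijective D.param := by
  constructor
  · rw [← LinearMap.ker_eq_bot, LinearMap.ker_eq_bot']
    rintro ⟨b, x, b'⟩ h
    rw [param_apply, ← add_assoc] at h
    obtain ⟨h1, h2, h3⟩ := D.eq_zero_of_add_eq_zero ⟨_, rfl⟩ x.2 b'.2 h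
    have h4 := D.eq_zero_of_d_eq_zero b.2 h1
    ext <;> assumption
  · intro a
    have htop : LinearMap.range A.d ⊔ (D.harmonic ⊔ D.coexact) = ⊤ := by
      rw [eq_top_iff, ← D.isInternal.submodule_iSup_eq_top]
      refine iSup_le fun i => ?_
      fin_cases i
      · exact le_sup_left
      · exact le_sup_left.trans le_sup_right
      · exact le_sup_right.trans le_sup_right
    have ha : a ∈ LinearMap.range A.d ⊔ (D.harmonic ⊔ D.coexact) := htop ▸ Submodule.mem_top
    obtain ⟨_, ⟨c, rfl⟩, w, hw, rfl⟩ := Submodule.mem_sup.1 ha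
    -- The exact part `d c` equals `d b`, where `b` is the component of `c` in `ℬ`.
    obtain ⟨x, hx, b', hb', rfl⟩ := Submodule.mem_sup.1 hw
    have hc : c ∈ LinearMap.range A.d ⊔ (D.harmonic ⊔ D.coexact) := htop ▸ Submodule.mem_top
    obtain ⟨_, ⟨e, rfl⟩, w, hw, rfl⟩ := Submodule.mem_sup.1 hc
    obtain ⟨y, hy, b, hb, rfl⟩ := Submodule.mem_sup.1 hw
    refine ⟨(⟨b, hb⟩, ⟨x, hx⟩, ⟨b', hb'⟩), ?_⟩
    rw [param_apply, map_add, map_add, A.d_d, D.d_harmonic hy, zero_add, zero_add]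

/-- The homotopy: the inverse of `d : ℬ → dA`, extended by zero to `ℋ ⊕ ℬ`. -/
noncomputable def homotopy : A.carrier →ₗ[F] A.carrier :=
  D.coexact.subtype ∘ₗ LinearMap.fst F _ _ ∘ₗ
    (LinearEquiv.ofBijective D.param D.param_bijective).symm.toLinearMap

/-- The projection onto `ℋ` with kernel `dA ⊕ ℬ`. -/
noncomputable def harmonicProj : A.carrier →ₗ[F] D.harmonic :=
  LinearMap.fst F _ _ ∘ₗ LinearMap.snd F _ _ ∘ₗ
    (LinearEquiv.ofBijective D.param D.param_bijective).symm.toLinearMap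

theorem homotopy_param (b : D.coexact) (x : D.harmonic) (b' : D.coexact) :
    D.homotopy (A.d b + (x + b')) = b := by
  have h := LinearEquiv.ofBijective_symm_apply_apply D.param (h := D.param_bijective) (b, x, b')
  change (((LinearEquiv.ofBijective D.param D.param_bijective).symm (D.param (b, x, b'))).1 :
    A.carrier) = b
  rw [h]

theorem harmonicProj_param (b : D.coexact) (x : D.harmonic) (b' : D.coexact) :
    D.harmonicProj (A.d b + (x + b')) = x := by
  have h := LinearEquiv.ofBijective_symm_apply_apply D.param (h := D.param_bijective) (b, x, b')
  change ((LinearEquiv.ofBijective D.param D.param_bijective).symm (D.param (b, x, b'))).2.1 = x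
  rw [h]

theorem homotopy_mem (a : A.carrier) : D.homotopy a ∈ D.coexact := by
  obtain ⟨⟨b, x, b'⟩, rfl⟩ := D.param_bijective.2 a
  rw [param_apply, homotopy_param]
  exact b.2

theorem homotopy_of_mem {x b' : A.carrier} (hx : x ∈ D.harmonic) (hb' : b' ∈ D.coexact) :
    D.homotopy (x + b') = 0 := by
  have := D.homotopy_param 0 ⟨x, hx⟩ ⟨b', hb'⟩
  simpa using this

theorem harmonicProj_of_mem {x b' : A.carrier} (hx : x ∈ D.harmonic) (hb' : b' ∈ D.coexact) :
    D.harmonicProj (x + b') = ⟨x, hx⟩ := by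
  have := D.harmonicProj_param 0 ⟨x, hx⟩ ⟨b', hb'⟩
  simpa using this

/-- A homogeneous element has homogeneous components in the Hodge type decomposition. -/
theorem exists_homogeneous_param {i : ℤ} {a : A.carrier} (ha : a ∈ A.gr i) :
    ∃ (b : D.coexact) (x : D.harmonic) (b' : D.coexact), a = A.d b + (x + b') ∧
      (b : A.carrier) ∈ A.gr (i - 1) ∧ (x : A.carrier) ∈ A.gr i := by
  obtain ⟨⟨b, x, b'⟩, rfl⟩ := D.param_bijective.2 a
  refine ⟨⟨A.component (i - 1) b, D.coexact_homogeneous _ b.2⟩,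
    ⟨A.component i x, D.isHarmonic.homogeneous _ x.2⟩,
    ⟨A.component i b', D.coexact_homogeneous _ b'.2⟩, ?_, (A.component (i - 1) _).2,
    (A.component i _).2⟩
  conv_lhs => rw [← A.component_same ha, param_apply, map_add, map_add]
  have := A.component_d (i - 1) b
  rw [sub_add_cancel] at this
  rw [Submodule.coe_add, Submodule.coe_add, this]

/-- The contraction of `A` onto the harmonic subspace. -/
noncomputable def contraction : Contraction A.toDGCA D.harmonicSpace where
  inc := D.harmonic.subtype
  proj := D.harmonicProj
  h := D.homotopy
  inc_mem _ _ hx := hx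
  proj_mem i a ha := by
    obtain ⟨b, x, b', rfl, -, hx⟩ := D.exists_homogeneous_param ha
    change (D.harmonicProj _ : A.carrier) ∈ A.gr i
    rw [harmonicProj_param]
    exact hx
  h_mem i a ha := by
    obtain ⟨b, x, b', rfl, hb, -⟩ := D.exists_homogeneous_param ha
    rw [homotopy_param]
    exact hb
  d_inc x := D.d_harmonic x.2
  proj_inc x := by
    have := D.harmonicProj_of_mem x.2 (zero_mem _)
    rwa [add_zero] at this
  h_inc x := by
    have := D.homotopy_of_mem x.2 (zero_mem _)
    rwa [add_zero] at this
  proj_h a := by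
    have := D.harmonicProj_of_mem (zero_mem _) (D.homotopy_mem a)
    rwa [zero_add] at this
  h_h a := by
    have := D.homotopy_of_mem (zero_mem _) (D.homotopy_mem a)
    rwa [zero_add] at this
  d_h a := by
    obtain ⟨⟨b, x, b'⟩, rfl⟩ := D.param_bijective.2 a
    have h1 : D.homotopy (A.d b') = b' := by
      have := D.homotopy_param b' 0 0
      simpa using this
    change A.d (D.homotopy (A.d b + (x + b'))) = A.d b + (x + b') -
      (D.harmonicProj (A.d b + (x + b')) : A.carrier) - D.homotopy (A.d (A.d b + (x + b')))
    rw [homotopy_param, harmonicProj_param, map_add A.d, map_add A.d, A.d_d,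
      D.d_harmonic x.2, zero_add, zero_add, h1]
    abel

end PoincareDGCA.HodgeDecomposition

/-! ### The integral and the pairing -/

namespace DGCA

variable {F : Type v} [Field F] (A : DGCA.{u, v} F)

/-- The class of a cocycle, as an element of the cohomology algebra. -/
noncomputable def cls : A.cocycles →ₐ[F] A.cohomology.carrier := A.pr

theorem cls_surjective : Function.Surjective A.cls := A.pr_surjective

theorem cls_eq_zero_iff (z : A.cocycles) : A.cls z = 0 ↔ ∃ x, A.d x = z := A.pr_eq_zero_iff z

theorem sum_cocyclesProj [∀ i (x : A.gr i), Decidable (x ≠ 0)] (z : A.cocycles) :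
    ∑ i ∈ (DirectSum.decompose A.gr (z : A.carrier)).support, A.cocyclesProj i z = z := by
  ext
  rw [AddSubmonoidClass.coe_finsetSum]
  exact DirectSum.sum_support_decompose A.gr (z : A.carrier)

theorem cls_mem {i : ℤ} {z : A.cocycles} (hz : (z : A.carrier) ∈ A.gr i) :
    A.cls z ∈ A.cohomology.gr i :=
  Submodule.mem_map_of_mem (p := A.cocyclesGr i) (f := A.pr.toLinearMap) hz

theorem component_cls (i : ℤ) (z : A.cocycles) :
    (A.cohomology.component i (A.cls z) : A.cohomology.carrier) = A.cls (A.cocyclesProj i z) := by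
  classical
  have key : ∀ j, (A.cohomology.component i (A.cls (A.cocyclesProj j z)) : A.cohomology.carrier) =
      A.cls (A.cocyclesProj i (A.cocyclesProj j z)) := by
    intro j
    have hj : ((A.cocyclesProj j z : A.cocycles) : A.carrier) ∈ A.gr j := (A.component j _).2
    by_cases h : j = i
    · subst h
      rw [A.cohomology.component_same (A.cls_mem hj)]
      exact congrArg A.cls (Subtype.ext (A.component_same hj).symm)
    · rw [A.cohomology.component_ne h (A.cls_mem hj)]
      have : A.cocyclesProj i (A.cocyclesProj j z) = 0 := Subtype.ext (A.component_ne h hj)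
      rw [this, map_zero]
  rw [← A.sum_cocyclesProj z]
  simp only [map_sum]
  rw [AddSubmonoidClass.coe_finsetSum]
  exact Finset.sum_congr rfl fun j _ => key j

end DGCA

namespace PoincareDGCA

variable {F : Type v} [Field F] {n : ℕ} (A : PoincareDGCA.{u, v} F n)

/-- The linear form `a ↦ ∫ [a_n]` on `A`. -/
noncomputable def integralForm : A.carrier →ₗ[F] F :=
  A.integral ∘ₗ A.cohomology.component n ∘ₗ A.cls.toLinearMap ∘ₗ A.topCocycle

theorem integralForm_of_ne {i : ℤ} (hi : i ≠ n) {a : A.carrier} (ha : a ∈ A.gr i) :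
    A.integralForm a = 0 := by
  have h : A.topCocycle a = 0 := Subtype.ext (A.component_ne hi ha)
  change A.integral (A.cohomology.component n (A.cls (A.topCocycle a))) = 0
  rw [h, map_zero, map_zero, map_zero]

theorem integralForm_d (a : A.carrier) : A.integralForm (A.d a) = 0 := by
  have h : A.cls (A.topCocycle (A.d a)) = 0 := by
    rw [A.cls_eq_zero_iff]
    refine ⟨A.component (n - 1) a, ?_⟩
    rw [← A.component_d, sub_add_cancel]
    rfl
  change A.integral (A.cohomology.component n (A.cls (A.topCocycle (A.d a)))) = 0
  rw [h, map_zero, map_zero]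

theorem cohomology_pairing (z w : A.cocycles) :
    A.cohomology.pairing n A.integral (A.cls z) (A.cls w) =
      A.integralForm ((z : A.carrier) * w) := by
  change A.integral (A.cohomology.component n (A.cls z * A.cls w)) =
    A.integral (A.cohomology.component n (A.cls (A.topCocycle ((z : A.carrier) * w))))
  congr 1
  rw [← map_mul]
  have h1 : A.topCocycle ((z : A.carrier) * w) = A.cocyclesProj n (z * w) := rfl
  rw [h1]
  apply Subtype.ext
  rw [A.component_cls, A.cohomology.component_same]
  exact A.cls_mem (A.component n _).2

namespace HodgeDecomposition

variable {A} (D : A.HodgeDecomposition)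

theorem exists_harmonic (c : A.cohomology.carrier) :
    ∃ (y : A.carrier) (hy : y ∈ D.harmonic), A.cls ⟨y, D.d_harmonic hy⟩ = c := by
  obtain ⟨w, rfl⟩ := A.cls_surjective c
  have hw : (w : A.carrier) ∈ D.harmonic ⊔ LinearMap.range A.d := by
    rw [D.isHarmonic.span]
    exact w.2
  obtain ⟨y, hy, x, ⟨v, rfl⟩, h⟩ := Submodule.mem_sup.1 hw
  refine ⟨y, hy, ?_⟩
  rw [← sub_eq_zero, ← map_sub, A.cls_eq_zero_iff]
  refine ⟨-v, ?_⟩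
  change A.d (-v) = y - w
  rw [map_neg, ← h]
  abel

theorem eq_zero_of_cls_eq_zero {x : A.carrier} (hx : x ∈ D.harmonic)
    (h : A.cls ⟨x, D.d_harmonic hx⟩ = 0) : x = 0 := by
  rw [A.cls_eq_zero_iff] at h
  have : x ∈ D.harmonic ⊓ LinearMap.range A.d := ⟨hx, h⟩
  rwa [D.isHarmonic.disjoint] at this

/-- Non-degeneracy of the Poincaré pairing, in terms of harmonic representatives. -/
theorem eq_zero_of_integralForm_mul {x : A.carrier} (hx : x ∈ D.harmonic)
    (h : ∀ y ∈ D.harmonic, A.integralForm (x * y) = 0) : x = 0 := by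
  apply D.eq_zero_of_cls_eq_zero hx
  apply A.poincare.nondegenerate
  intro c
  obtain ⟨y, hy, rfl⟩ := D.exists_harmonic c
  rw [A.cohomology_pairing]
  exact h y hy

theorem eq_zero_of_integralForm_mul_homogeneous {l : ℤ} {x : A.carrier} (hx : x ∈ D.harmonic)
    (hxl : x ∈ A.gr l)
    (h : ∀ y ∈ D.harmonic, y ∈ A.gr (n - l) → A.integralForm (x * y) = 0) : x = 0 := by
  classical
  refine D.eq_zero_of_integralForm_mul hx fun y hy => ?_
  rw [← DirectSum.sum_support_decompose A.gr y, Finset.mul_sum, map_sum]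
  refine Finset.sum_eq_zero fun j _ => ?_
  by_cases hj : j = n - l
  · subst hj
    exact h _ (D.isHarmonic.homogeneous _ hy) (DirectSum.decompose A.gr y _).2
  · exact A.integralForm_of_ne (i := l + j) (by omega)
      (SetLike.GradedMul.mul_mem hxl (DirectSum.decompose A.gr y j).2)

theorem integralForm_mul_coexact {x y : A.carrier} (hx : x ∈ D.harmonic ⊔ D.coexact)
    (hy : y ∈ D.coexact) : A.integralForm (x * y) = 0 :=
  D.orthogonal x hx y hy

/-- The pairing is graded symmetric, so `ℬ` is also left orthogonal to `ℋ ⊕ ℬ`. -/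
theorem integralForm_coexact_mul {x y : A.carrier} (hx : x ∈ D.coexact)
    (hy : y ∈ D.harmonic ⊔ D.coexact) : A.integralForm (x * y) = 0 := by
  classical
  have hhom : (D.harmonic ⊔ D.coexact).IsHomogeneous A.gr := by
    intro i z hz
    obtain ⟨z1, h1, z2, h2, rfl⟩ := Submodule.mem_sup.1 hz
    rw [DirectSum.decompose_add]
    exact add_mem (Submodule.mem_sup_left (D.isHarmonic.homogeneous i h1))
      (Submodule.mem_sup_right (D.coexact_homogeneous i h2))
  rw [← DirectSum.sum_support_decompose A.gr x, ← DirectSum.sum_support_decompose A.gr y,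
    Finset.sum_mul, map_sum]
  refine Finset.sum_eq_zero fun i _ => ?_
  rw [Finset.mul_sum, map_sum]
  refine Finset.sum_eq_zero fun j _ => ?_
  rw [A.graded_comm i j _ _ (DirectSum.decompose A.gr x i).2 (DirectSum.decompose A.gr y j).2,
    Units.smul_def, map_zsmul,
    D.integralForm_mul_coexact (hhom j hy) (D.coexact_homogeneous i hx), smul_zero]

theorem integralForm_coexact (h1 : (1 : A.carrier) ∈ D.harmonic) {x : A.carrier}
    (hx : x ∈ D.coexact) : A.integralForm x = 0 := by
  rw [← one_mul x]
  exact D.integralForm_mul_coexact (Submodule.mem_sup_left h1) hx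

theorem one_mem_harmonic : (1 : A.carrier) ∈ D.harmonic := by
  have h0 : D.homotopy 1 ∈ A.gr (0 - 1) :=
    D.contraction.h_mem 0 1 SetLike.GradedOne.one_mem
  rw [A.gr_neg _ (by omega), Submodule.mem_bot] at h0
  have h := D.contraction.d_h 1
  change A.d (D.homotopy 1) = 1 - (D.harmonicProj 1 : A.carrier) - D.homotopy (A.d 1) at h
  rw [h0, A.d_one, map_zero, map_zero, sub_zero] at h
  rw [sub_eq_zero.1 h.symm]
  exact (D.harmonicProj 1).2

/-- Below the degree of connectivity there are no harmonic elements of positive degree. -/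
theorem eq_zero_of_connected {k : ℕ} (hconn : A.IsConnectedUpTo k) {i : ℤ} (hi : i ≠ 0)
    (hik : i ≤ k) {x : A.carrier} (hx : x ∈ D.harmonic) (hxi : x ∈ A.gr i) : x = 0 := by
  rcases lt_or_gt_of_ne hi with h | h
  · rwa [A.gr_neg i h, Submodule.mem_bot] at hxi
  · apply D.eq_zero_of_cls_eq_zero hx
    have := A.cls_mem (z := ⟨x, D.d_harmonic hx⟩) hxi
    rwa [hconn.2 i (by omega) hik, Submodule.mem_bot] at this

end HodgeDecomposition

end PoincareDGCA

/-- In a connected DGCA, the cocycles of degree `0` are the multiples of the unit, as there are no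
coboundaries of degree `0`. -/
theorem DGCA.eq_smul_one_of_connected {F : Type v} [Field F] (A : DGCA.{u, v} F) {k : ℕ}
    (hconn : A.IsConnectedUpTo k) {x : A.carrier} (hx : x ∈ A.gr 0) (hd : A.d x = 0) :
    ∃ c : F, x = c • (1 : A.carrier) := by
  obtain ⟨⟨e⟩, -⟩ := hconn
  have hone : A.cls 1 ∈ A.cohomology.gr 0 := A.cls_mem SetLike.GradedOne.one_mem
  have hxm : A.cls ⟨x, hd⟩ ∈ A.cohomology.gr 0 := A.cls_mem hx
  have hne : e ⟨A.cls 1, hone⟩ ≠ 0 := by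
    intro h
    have h1 : A.cls 1 = 0 := by
      have := e.map_eq_zero_iff.1 h
      exact congrArg Subtype.val this
    have h2 : ∀ y : A.cohomology.gr 0, y = 0 := by
      rintro ⟨y, hy⟩
      obtain ⟨z, rfl⟩ := A.cls_surjective y
      apply Subtype.ext
      change A.cls z = 0
      rw [← mul_one z, map_mul, h1, mul_zero]
    have h3 := h2 (e.symm 1)
    rw [LinearEquiv.map_eq_zero_iff] at h3
    exact one_ne_zero h3
  refine ⟨e ⟨A.cls ⟨x, hd⟩, hxm⟩ / e ⟨A.cls 1, hone⟩, ?_⟩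
  set c := e ⟨A.cls ⟨x, hd⟩, hxm⟩ / e ⟨A.cls 1, hone⟩ with hc
  have h1 : (⟨A.cls ⟨x, hd⟩, hxm⟩ : A.cohomology.gr 0) = c • ⟨A.cls 1, hone⟩ := by
    apply e.injective
    rw [map_smul, hc, smul_eq_mul, div_mul_cancel₀ _ hne]
  have h2 : A.cls ⟨x, hd⟩ = c • A.cls 1 := congrArg Subtype.val h1
  rw [← map_smul, ← sub_eq_zero, ← map_sub, A.cls_eq_zero_iff] at h2
  obtain ⟨y, hy⟩ := h2
  change A.d y = x - c • (1 : A.carrier) at hy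
  have h3 : x - c • (1 : A.carrier) ∈ A.gr 0 :=
    sub_mem hx (Submodule.smul_mem _ _ SetLike.GradedOne.one_mem)
  have h4 := A.component_d (-1) y
  have h5 : (A.component (-1) y : A.carrier) = 0 := by
    rw [← Submodule.mem_bot F, ← A.gr_neg (-1) (by omega)]
    exact (A.component (-1) y).2
  rw [h5, map_zero, hy, neg_add_cancel, A.component_same h3] at h4
  exact sub_eq_zero.1 h4

/-! ### Vanishing of the higher operations -/

namespace Contraction

variable {F : Type v} [Field F] {A : DGCA.{u, v} F} {V : GradedSpace.{u, v} F} (C : Contraction A V)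

theorem h_phi (N : ℕ) (a : ℕ → V.carrier) : C.h (C.phi N a) = 0 := by
  rw [phi_eq, map_add, C.h_h, add_zero]
  split_ifs
  · exact C.h_inc _
  · exact map_zero _

/-- The transferred structure is strictly unital: if a letter is a multiple of the unit, then `λ_N`
is a multiple of `φ_{N-1}`, up to sign. -/
theorem h_lam_proj_lam_of_unit (c : F) {N : ℕ} (hN : 2 ≤ N) (a : ℕ → V.carrier) (i : ℕ)
    (hi : i < N) (hu : C.inc (a i) = c • (1 : A.carrier)) :
    C.h (C.lam N a) = 0 ∧ (3 ≤ N → C.proj (C.lam N a) = 0) := by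
  induction N using Nat.strong_induction_on generalizing a i with
  | _ N ih =>
    have hphi : ∀ M < N, 2 ≤ M → ∀ (a : ℕ → V.carrier) (i : ℕ), i < M →
        C.inc (a i) = c • (1 : A.carrier) → C.phi M a = 0 := fun M hM hM2 a i hi hu => by
      rw [C.phi_of_two_le hM2, (ih M hM hM2 a i hi hu).1]
    have hsign : A.toGradedSpace.sign (c • (1 : A.carrier)) = c • (1 : A.carrier) := by
      rw [A.toGradedSpace.sign_of_mem (i := 0)
        (Submodule.smul_mem _ _ SetLike.GradedOne.one_mem)]
      simp
    have key : ∀ k ∈ Finset.Ico 1 N,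
        C.h (-A.toGradedSpace.sign (C.phi k a) * C.phi (N - k) fun j => a (k + j)) = 0 ∧
        (3 ≤ N →
          C.proj (-A.toGradedSpace.sign (C.phi k a) * C.phi (N - k) fun j => a (k + j)) = 0) := by
      intro k hk
      rw [Finset.mem_Ico] at hk
      by_cases hik : i < k
      · by_cases hk1 : k = 1
        · obtain rfl : i = 0 := by omega
          subst hk1
          rw [phi_one, hu, hsign, neg_mul, smul_mul_assoc, one_mul, map_neg, map_neg, map_smul,
            map_smul, C.h_phi, smul_zero, neg_zero]
          refine ⟨rfl, fun h => ?_⟩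
          rw [proj_phi, if_neg (by omega), smul_zero, neg_zero]
        · rw [hphi k hk.2 (by omega) a i hik hu]
          simp
      · by_cases hk1 : N - k = 1
        · have hk2 : i = k := by omega
          have hk3 : k = N - 1 := by omega
          have e : (C.phi (N - k) fun j => a (k + j)) = c • (1 : A.carrier) := by
            rw [hk1, phi_one, add_zero, ← hk2, hu]
          have hs := C.sign_h (C.lam k a)
          rw [e, mul_smul_comm, mul_one, map_smul, map_smul, map_neg, map_neg]
          constructor
          · have := C.sign_h (C.phi k a)
            rw [h_phi, map_zero] at this
            rw [← this, smul_zero]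
          · intro h3
            rw [C.phi_of_two_le (by omega), hs, map_neg, C.proj_h, neg_zero, neg_zero, smul_zero]
        · rw [hphi (N - k) (by omega) (by omega) (fun j => a (k + j)) (i - k) (by omega)
            (by rw [Nat.add_sub_cancel' (by omega), hu])]
          simp
    constructor
    · rw [lam, WordMap.conv, map_sum]
      exact Finset.sum_eq_zero fun k hk => (key k hk).1
    · intro h3
      rw [lam, WordMap.conv, map_sum]
      exact Finset.sum_eq_zero fun k hk => (key k hk).2 h3

/-- A transferred operation vanishes if it vanishes on homogeneous elements. -/
theorem transfer_eq_zero {k : ℕ}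
    (h : ∀ (p : ℕ → ℤ) (a : ℕ → V.carrier), (∀ i, a i ∈ V.gr (p i)) → C.bar k a = 0) :
    C.transfer.m k = 0 := by
  classical
  ext x
  have hx : x = fun i => ∑ j ∈ (DirectSum.decompose V.gr (x i)).support,
      (DirectSum.decompose V.gr (x i) j : V.carrier) :=
    funext fun i => (DirectSum.sum_support_decompose V.gr (x i)).symm
  rw [hx, MultilinearMap.map_sum_finset]
  refine Finset.sum_eq_zero fun q _ => ?_
  let p : ℕ → ℤ := fun i => if hi : i < k then q ⟨i, hi⟩ else 0
  let a : ℕ → V.carrier := fun i =>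
    if hi : i < k then (DirectSum.decompose V.gr (x ⟨i, hi⟩) (q ⟨i, hi⟩) : V.carrier) else 0
  have ha : ∀ i, a i ∈ V.gr (p i) := by
    intro i
    by_cases hi : i < k
    · simp only [a, p, dif_pos hi]
      exact SetLike.coe_mem _
    · simp only [a, p, dif_neg hi]
      exact zero_mem _
  have e : (fun i : Fin k => (DirectSum.decompose V.gr (x i) (q i) : V.carrier)) =
      fun i : Fin k => a i := by
    funext i
    simp only [a, dif_pos i.2]
  rw [e]
  change unsuspend C.bar C.bar_isLocal C.bar_isMultilinear k (fun i => a i) = 0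
  rw [unsuspend_apply _ _ k ha, h p a ha, smul_zero]

end Contraction

namespace PoincareDGCA.HodgeDecomposition

variable {F : Type v} [Field F] {n : ℕ} {A : PoincareDGCA.{u, v} F n} (D : A.HodgeDecomposition)

theorem inc_mem_harmonic (x : D.harmonicSpace.carrier) : D.contraction.inc x ∈ D.harmonic :=
  Subtype.property (p := (· ∈ D.harmonic)) x

theorem phi_mem_harmonic_sup_coexact (N : ℕ) (a : ℕ → D.harmonicSpace.carrier) :
    D.contraction.phi N a ∈ D.harmonic ⊔ D.coexact := by
  rw [Contraction.phi_eq]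
  refine add_mem ?_ (Submodule.mem_sup_right (D.homotopy_mem _))
  split_ifs
  · exact Submodule.mem_sup_left (D.inc_mem_harmonic _)
  · exact zero_mem _

theorem phi_mem_coexact {N : ℕ} (hN : 2 ≤ N) (a : ℕ → D.harmonicSpace.carrier) :
    D.contraction.phi N a ∈ D.coexact := by
  rw [Contraction.phi_of_two_le _ hN]
  exact D.homotopy_mem _

/-- The integral of `∑ ± φ_i · φ_{N-i}` vanishes for `N ≥ 3`, as in each summand one of the factors
lies in `ℬ` and the other one in `ℋ ⊕ ℬ`. -/
theorem integralForm_lam {N : ℕ} (hN : 3 ≤ N) {p : ℕ → ℤ} {a : ℕ → D.harmonicSpace.carrier}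
    (ha : ∀ i, a i ∈ D.harmonicSpace.gr (p i)) :
    A.integralForm (D.contraction.lam N a) = 0 := by
  rw [Contraction.lam, WordMap.conv, map_sum]
  refine Finset.sum_eq_zero fun i hi => ?_
  rw [Finset.mem_Ico] at hi
  rw [A.toGradedSpace.sign_of_mem (D.contraction.phi_mem i p a ha), neg_mul, map_neg,
    Units.smul_def, smul_mul_assoc, map_zsmul]
  have h : A.integralForm (D.contraction.phi i a * D.contraction.phi (N - i) fun j => a (i + j)) =
      0 := by
    by_cases h2 : 2 ≤ i
    · exact D.integralForm_coexact_mul (D.phi_mem_coexact h2 _)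
        (D.phi_mem_harmonic_sup_coexact _ _)
    · exact D.integralForm_mul_coexact (D.phi_mem_harmonic_sup_coexact _ _)
        (D.phi_mem_coexact (by omega) _)
  rw [h, smul_zero, neg_zero]

/-- The operation `m_k` vanishes if its values on arguments of degree at least `r` have degree
greater than `n - r`. -/
theorem transfer_m_eq_zero {r k : ℕ} (hr : 1 < r) (hconn : A.IsConnectedUpTo (r - 1))
    (hk : 3 ≤ k) (hnk : n + k < (k + 1) * r + 2) : D.contraction.transfer.m k = 0 := by
  refine D.contraction.transfer_eq_zero fun p a ha => ?_
  rw [Contraction.bar, neg_eq_zero]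
  by_cases hunit : ∃ i < k, p i = 0
  · obtain ⟨i, hi, hpi⟩ := hunit
    have hai := D.contraction.inc_mem _ _ (ha i)
    rw [hpi] at hai
    obtain ⟨c, hc⟩ := A.eq_smul_one_of_connected hconn hai (D.contraction.d_inc (a i))
    exact (D.contraction.h_lam_proj_lam_of_unit c (by omega) a i hi hc).2 hk
  by_cases hzero : ∃ i < k, a i = 0
  · obtain ⟨i, hi, hai⟩ := hzero
    have h := (D.contraction.phi_lam_isMultilinear.2 k a i hi).map_zero
    rw [← hai, Function.update_eq_self] at h
    rw [h, map_zero]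
  push Not at hunit hzero
  -- All letters are nonzero and have degree at least `r`.
  have hp : ∀ i ∈ Finset.range k, (r : ℤ) ≤ p i := by
    intro i hi
    rw [Finset.mem_range] at hi
    by_contra hlt
    exact hzero i hi (Subtype.ext (D.eq_zero_of_connected hconn (hunit i hi) (by omega)
      (D.inc_mem_harmonic (a i)) (ha i)))
  have hsum := Finset.sum_le_sum hp
  rw [Finset.sum_const, Finset.card_range, nsmul_eq_mul] at hsum
  set l : ℤ := ∑ i ∈ Finset.range k, p i + 2 - k with hl
  have hxl : (D.harmonicProj (D.contraction.lam k a) : A.carrier) ∈ A.gr l :=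
    D.contraction.proj_mem _ _ (D.contraction.lam_mem k p a ha)
  have hint : A.integralForm (D.harmonicProj (D.contraction.lam k a)) = 0 := by
    have h := D.contraction.d_h (D.contraction.lam k a)
    change A.d (D.homotopy (D.contraction.lam k a)) = D.contraction.lam k a -
      (D.harmonicProj (D.contraction.lam k a) : A.carrier) -
        D.homotopy (A.d (D.contraction.lam k a)) at h
    have h2 := congrArg A.integralForm h
    rw [map_sub, map_sub, A.integralForm_d, D.integralForm_lam hk ha,
      D.integralForm_coexact D.one_mem_harmonic (D.homotopy_mem _)] at h2
    simpa using h2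
  apply Subtype.ext
  change (D.harmonicProj (D.contraction.lam k a) : A.carrier) = 0
  refine D.eq_zero_of_integralForm_mul_homogeneous (D.harmonicProj _).2 hxl fun y hy hyl => ?_
  by_cases hnl : (n : ℤ) - l = 0
  · rw [hnl] at hyl
    obtain ⟨c, rfl⟩ := A.eq_smul_one_of_connected hconn hyl (D.d_harmonic hy)
    rw [mul_smul_comm, mul_one, map_smul, hint, smul_zero]
  · rw [D.eq_zero_of_connected hconn hnl _ hy hyl, mul_zero, map_zero]
    zify at hnk
    have : ((r - 1 : ℕ) : ℤ) = r - 1 := by omega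
    rw [this]
    linarith

end PoincareDGCA.HodgeDecomposition

/-! ### Formality -/

namespace DGCA

variable {F : Type v} [Field F]

/-- A graded subalgebra stable under the differential, as a DGCA. -/
noncomputable def ofSubalgebra (A : DGCA.{u, v} F) (S : Subalgebra F A.carrier)
    (hS : (Subalgebra.toSubmodule S).IsHomogeneous A.gr) (hd : ∀ a ∈ S, A.d a ∈ S) :
    DGCA.{u, v} F where
  carrier := S
  gr i := (A.gr i).comap S.val.toLinearMap
  gradedAlgebra :=
    { toDecomposition :=
        (A.isInternal_of_isHomogeneous (Subalgebra.toSubmodule S) hS).chooseDecomposition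
      one_mem := show (1 : A.carrier) ∈ A.gr 0 from SetLike.GradedOne.one_mem
      mul_mem := fun {i j} x y hx hy =>
        show (x * y : A.carrier) ∈ A.gr (i + j) from SetLike.GradedMul.mul_mem hx hy }
  gr_neg i hi := by
    rw [A.gr_neg i hi, Submodule.comap_bot, LinearMap.ker_eq_bot]
    exact Subtype.val_injective
  graded_comm i j a b ha hb := Subtype.ext (A.graded_comm i j a b ha hb)
  d := A.d.restrict (p := Subalgebra.toSubmodule S) (q := Subalgebra.toSubmodule S) hd
  d_mem i a ha := A.d_mem i a ha
  d_d a := Subtype.ext (A.d_d a)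
  leibniz i a b ha := Subtype.ext (A.leibniz i a b ha)

variable (A : DGCA.{u, v} F)

theorem component_component (i j : ℤ) (a : A.carrier) :
    (A.component i (A.component j a) : A.carrier) =
      if i = j then (A.component i a : A.carrier) else 0 := by
  split_ifs with h
  · subst h
    exact A.component_same (A.component i a).2
  · exact A.component_ne (Ne.symm h) (A.component j a).2

/-- Products of elements without components in low degrees vanish. -/
theorem mul_eq_zero_of_component_eq_zero {n : ℤ} (hn : ∀ k, n < k → A.gr k = ⊥) {m m' : ℤ}
    (hm : n < m + m') {a b : A.carrier} (ha : ∀ i < m, (A.component i a : A.carrier) = 0)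
    (hb : ∀ i < m', (A.component i b : A.carrier) = 0) : a * b = 0 := by
  classical
  rw [← DirectSum.sum_support_decompose A.gr a, ← DirectSum.sum_support_decompose A.gr b,
    Finset.sum_mul]
  refine Finset.sum_eq_zero fun i _ => ?_
  rw [Finset.mul_sum]
  refine Finset.sum_eq_zero fun j _ => ?_
  rw [← A.coe_component, ← A.coe_component]
  by_cases hi : i < m
  · rw [ha i hi, zero_mul]
  · by_cases hj : j < m'
    · rw [hb j hj, mul_zero]
    · rw [← Submodule.mem_bot F, ← hn (i + j) (by omega)]
      exact SetLike.GradedMul.mul_mem (A.component i a).2 (A.component j b).2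

end DGCA

namespace PoincareDGCA.HodgeDecomposition

variable {F : Type v} [Field F] {n : ℕ} {A : PoincareDGCA.{u, v} F n} (D : A.HodgeDecomposition)

theorem component_homotopy (i : ℤ) (a : A.carrier) :
    (A.component i (D.homotopy a) : A.carrier) = D.homotopy (A.component (i + 1) a) := by
  induction a using A.homogeneous_induction with
  | hom j a ha =>
    have hh : D.homotopy a ∈ A.gr (j - 1) := D.contraction.h_mem j a ha
    by_cases h : j = i + 1
    · subst h
      rw [add_sub_cancel_right] at hh
      rw [A.component_same hh, A.component_same ha]
    · rw [A.component_ne (by omega) hh, A.component_ne h ha, map_zero]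
  | add a b ha hb => simp only [map_add, Submodule.coe_add, ha, hb]

theorem homotopy_homotopy (a : A.carrier) : D.homotopy (D.homotopy a) = 0 := D.contraction.h_h a

theorem homotopy_harmonic {x : A.carrier} (hx : x ∈ D.harmonic) : D.homotopy x = 0 :=
  D.contraction.h_inc ⟨x, hx⟩

theorem harmonicProj_harmonic {x : A.carrier} (hx : x ∈ D.harmonic) :
    (D.harmonicProj x : A.carrier) = x :=
  congrArg Subtype.val (D.contraction.proj_inc ⟨x, hx⟩)

theorem d_homotopy (a : A.carrier) :
    A.d (D.homotopy a) = a - (D.harmonicProj a : A.carrier) - D.homotopy (A.d a) :=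
  D.contraction.d_h a

theorem harmonicProj_d (a : A.carrier) : D.harmonicProj (A.d a) = 0 := D.contraction.proj_d a

theorem mem_harmonic_of_eq_zero {a : A.carrier} (hd : A.d a = 0) (hh : D.homotopy a = 0) :
    a ∈ D.harmonic := by
  have h := D.d_homotopy a
  rw [hh, hd, map_zero, map_zero, sub_zero] at h
  rw [sub_eq_zero.1 h.symm]
  exact (D.harmonicProj a).2

/-- The elements of `A` which are harmonic in degrees `≤ 2r-2` and whose component of degree
`2r-1` lies in `ℋ ⊕ ℬ`. -/
def small (r : ℤ) : Submodule F A.carrier where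
  carrier := {a | ∀ i : ℤ, (i ≤ 2 * r - 2 → A.d (A.component i a) = 0) ∧
    (i ≤ 2 * r - 1 → D.homotopy (A.component i a) = 0)}
  zero_mem' i := by simp
  add_mem' {a b} ha hb i := by
    refine ⟨fun h => ?_, fun h => ?_⟩
    · rw [map_add, Submodule.coe_add, map_add, (ha i).1 h, (hb i).1 h, add_zero]
    · rw [map_add, Submodule.coe_add, map_add, (ha i).2 h, (hb i).2 h, add_zero]
  smul_mem' c a ha i := by
    refine ⟨fun h => ?_, fun h => ?_⟩
    · rw [map_smul, Submodule.coe_smul, map_smul, (ha i).1 h, smul_zero]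
    · rw [map_smul, Submodule.coe_smul, map_smul, (ha i).2 h, smul_zero]

theorem small_isHomogeneous (r : ℤ) : (D.small r).IsHomogeneous A.gr := by
  intro j a ha i
  rw [← A.coe_component, A.component_component]
  split_ifs
  · exact ha i
  · simp

theorem mem_small_of_mem_gr {r i : ℤ} {a : A.carrier} (ha : a ∈ A.gr i)
    (hd : i ≤ 2 * r - 2 → A.d a = 0) (hh : i ≤ 2 * r - 1 → D.homotopy a = 0) :
    a ∈ D.small r := by
  intro j
  by_cases h : i = j
  · subst h
    rw [A.component_same ha]
    exact ⟨hd, hh⟩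
  · rw [A.component_ne h ha]
    simp

theorem harmonic_le_small (r : ℤ) : D.harmonic ≤ D.small r := by
  intro x hx i
  have h : (A.component i x : A.carrier) ∈ D.harmonic := D.isHarmonic.homogeneous i hx
  exact ⟨fun _ => D.d_harmonic h, fun _ => D.homotopy_harmonic h⟩

theorem d_mem_small {r : ℤ} {a : A.carrier} (ha : a ∈ D.small r) : A.d a ∈ D.small r := by
  intro i
  have h := A.component_d (i - 1) a
  rw [sub_add_cancel] at h
  rw [h]
  refine ⟨fun _ => A.d_d _, fun hi => ?_⟩
  rw [(ha (i - 1)).1 (by omega), map_zero]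

theorem homotopy_mem_small {r : ℤ} {a : A.carrier} (ha : a ∈ D.small r) :
    D.homotopy a ∈ D.small r := by
  intro i
  rw [D.component_homotopy]
  refine ⟨fun hi => ?_, fun _ => D.homotopy_homotopy _⟩
  rw [(ha (i + 1)).2 (by omega), map_zero]

theorem component_homotopy_of_mem_small {r : ℤ} {a : A.carrier} (ha : a ∈ D.small r) {i : ℤ}
    (hi : i < 2 * r - 1) : (A.component i (D.homotopy a) : A.carrier) = 0 := by
  rw [D.component_homotopy, (ha (i + 1)).2 (by omega)]

theorem component_d_homotopy_of_mem_small {r : ℤ} {a : A.carrier} (ha : a ∈ D.small r) {i : ℤ}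
    (hi : i < 2 * r) : (A.component i (A.d (D.homotopy a)) : A.carrier) = 0 := by
  have h := A.component_d (i - 1) (D.homotopy a)
  rw [sub_add_cancel] at h
  rw [h, D.component_homotopy_of_mem_small ha (by omega), map_zero]

/-- In an `(r-1)`-connected algebra, a product of two non-constant elements of the small subspace
has degree at least `2r`, where there is no condition on the elements of the small subspace. -/
theorem mul_mem_small {r : ℕ} (hr : 1 < r) (hconn : A.IsConnectedUpTo (r - 1))
    {a b : A.carrier} (ha : a ∈ D.small r) (hb : b ∈ D.small r) :
    a * b ∈ D.small r := by
  classical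
  have low : ∀ (i : ℤ) (c : A.carrier), c ∈ A.gr i → c ∈ D.small r → i < r → i ≠ 0 → c = 0 := by
    intro i c hci hc hir hi
    have h := hc i
    rw [A.component_same hci] at h
    exact D.eq_zero_of_connected hconn hi (by omega)
      (D.mem_harmonic_of_eq_zero (h.1 (by omega)) (h.2 (by omega))) hci
  have const : ∀ c : A.carrier, c ∈ A.gr 0 → c ∈ D.small r → ∃ t : F, c = t • (1 : A.carrier) := by
    intro c hc0 hc
    have h := hc 0
    rw [A.component_same hc0] at h
    exact A.eq_smul_one_of_connected hconn hc0 (h.1 (by omega))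
  rw [← DirectSum.sum_support_decompose A.gr a, ← DirectSum.sum_support_decompose A.gr b,
    Finset.sum_mul]
  refine Submodule.sum_mem _ fun i _ => ?_
  rw [Finset.mul_sum]
  refine Submodule.sum_mem _ fun j _ => ?_
  have hai := D.small_isHomogeneous r i ha
  have hbj := D.small_isHomogeneous r j hb
  have hai' := (DirectSum.decompose A.gr a i).2
  have hbj' := (DirectSum.decompose A.gr b j).2
  -- A homogeneous factor is constant, zero, or of degree at least `r`.
  by_cases hi0 : i = 0
  · subst hi0
    obtain ⟨t, ht⟩ := const _ hai' hai
    rw [ht, smul_mul_assoc, one_mul]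
    exact Submodule.smul_mem _ _ hbj
  by_cases hj0 : j = 0
  · subst hj0
    obtain ⟨t, ht⟩ := const _ hbj' hbj
    rw [ht, mul_smul_comm, mul_one]
    exact Submodule.smul_mem _ _ hai
  by_cases hir : i < r
  · rw [low i _ hai' hai hir hi0, zero_mul]
    exact zero_mem _
  by_cases hjr : j < r
  · rw [low j _ hbj' hbj hjr hj0, mul_zero]
    exact zero_mem _
  exact D.mem_small_of_mem_gr (SetLike.GradedMul.mul_mem hai' hbj') (fun h => by omega)
    (fun h => by omega)

theorem integralForm_harmonic_mul_d {x : A.carrier} (hx : x ∈ D.harmonic) (a : A.carrier) :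
    A.integralForm (x * A.d a) = 0 := by
  obtain ⟨y, hy⟩ := A.exists_mul_d x a (D.d_harmonic hx)
  rw [← hy, A.integralForm_d]

theorem integralForm_d_mul_harmonic {x : A.carrier} (hx : x ∈ D.harmonic) (a : A.carrier) :
    A.integralForm (A.d a * x) = 0 := by
  rw [← A.d_mul_of_cocycle a (D.d_harmonic hx), A.integralForm_d]

/-- The product lies in degrees `≥ 4r - 1`, where `A` vanishes. -/
theorem d_homotopy_mul_homotopy {r : ℕ} (hr : 1 < r) (hn : n ≤ 4 * r - 2) {z t : A.carrier}
    (hz : z ∈ D.small r) (ht : t ∈ D.small r) : A.d (D.homotopy z) * D.homotopy t = 0 :=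
  A.mul_eq_zero_of_component_eq_zero (n := n) A.bounded (m := 2 * r) (m' := 2 * r - 1)
    (by omega) (fun _ hi => D.component_d_homotopy_of_mem_small hz hi)
    (fun _ hi => D.component_homotopy_of_mem_small ht hi)

theorem homotopy_mul_d_homotopy {r : ℕ} (hr : 1 < r) (hn : n ≤ 4 * r - 2) {z t : A.carrier}
    (hz : z ∈ D.small r) (ht : t ∈ D.small r) : D.homotopy z * A.d (D.homotopy t) = 0 :=
  A.mul_eq_zero_of_component_eq_zero (n := n) A.bounded (m := 2 * r - 1) (m' := 2 * r)
    (by omega) (fun _ hi => D.component_homotopy_of_mem_small hz hi)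
    (fun _ hi => D.component_d_homotopy_of_mem_small ht hi)

/-- The kernel of the harmonic projection on the small subspace lies in the radical of the
pairing. -/
theorem integralForm_mul_of_harmonicProj_eq_zero {r : ℕ} (hr : 1 < r) (hn : n ≤ 4 * r - 2)
    {z t : A.carrier} (hz : z ∈ D.small r) (ht : t ∈ D.small r) (hPz : D.harmonicProj z = 0) :
    A.integralForm (z * t) = 0 ∧ A.integralForm (t * z) = 0 := by
  have hdz := D.d_mem_small hz
  have hdt := D.d_mem_small ht
  have ez : z = A.d (D.homotopy z) + D.homotopy (A.d z) := by
    rw [D.d_homotopy, hPz]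
    simp
  have et : t = D.harmonicProj t + (A.d (D.homotopy t) + D.homotopy (A.d t)) := by
    rw [D.d_homotopy]
    abel
  have hdd : ∀ x y, A.integralForm (A.d x * A.d y) = 0 := fun x y => by
    rw [← A.d_mul_of_cocycle x (A.d_d y), A.integralForm_d]
  have hx := (D.harmonicProj t).2
  have hB : ∀ a, D.homotopy a ∈ D.harmonic ⊔ D.coexact := fun a =>
    Submodule.mem_sup_right (D.homotopy_mem a)
  constructor
  · rw [ez, et]
    simp only [add_mul, mul_add, map_add]
    rw [D.integralForm_d_mul_harmonic hx, hdd, D.d_homotopy_mul_homotopy hr hn hz hdt,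
      D.integralForm_coexact_mul (D.homotopy_mem _) (Submodule.mem_sup_left hx),
      D.homotopy_mul_d_homotopy hr hn hdz ht,
      D.integralForm_coexact_mul (D.homotopy_mem _) (hB _)]
    simp
  · rw [ez, et]
    simp only [add_mul, mul_add, map_add]
    rw [D.integralForm_harmonic_mul_d hx, hdd, D.d_homotopy_mul_homotopy hr hn ht hdz,
      D.integralForm_mul_coexact (Submodule.mem_sup_left hx) (D.homotopy_mem _),
      D.homotopy_mul_d_homotopy hr hn hdt hz,
      D.integralForm_mul_coexact (hB _) (D.homotopy_mem _)]
    simp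

theorem integralForm_harmonicProj_mul (a : A.carrier) {y : A.carrier} (hy : y ∈ D.harmonic) :
    A.integralForm (D.harmonicProj a * y) = A.integralForm (a * y) := by
  have h : (D.harmonicProj a : A.carrier) =
      a - A.d (D.homotopy a) - D.homotopy (A.d a) := by
    rw [D.d_homotopy]
    abel
  rw [h, sub_mul, sub_mul, map_sub, map_sub, D.integralForm_d_mul_harmonic hy,
    D.integralForm_coexact_mul (D.homotopy_mem _) (Submodule.mem_sup_left hy), sub_zero, sub_zero]

/-- The kernel of the harmonic projection is a two-sided ideal in the small subspace. -/
theorem harmonicProj_mul_eq_zero {r : ℕ} (hr : 1 < r) (hn : n ≤ 4 * r - 2)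
    (hconn : A.IsConnectedUpTo (r - 1)) {z t : A.carrier} (hz : z ∈ D.small r)
    (ht : t ∈ D.small r) (hPz : D.harmonicProj z = 0) :
    D.harmonicProj (z * t) = 0 ∧ D.harmonicProj (t * z) = 0 := by
  -- The first half is needed for the second one, as `(t z) y = t (z y)` and `z y` is again in the
  -- kernel.
  have h1 : ∀ s ∈ D.small r, D.harmonicProj (z * s) = 0 := by
    intro s hs
    refine Subtype.ext (D.eq_zero_of_integralForm_mul (D.harmonicProj _).2 fun y hy => ?_)
    rw [D.integralForm_harmonicProj_mul _ hy, mul_assoc]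
    exact (D.integralForm_mul_of_harmonicProj_eq_zero hr hn hz
      (D.mul_mem_small hr hconn hs (D.harmonic_le_small r hy)) hPz).1
  refine ⟨h1 t ht, ?_⟩
  refine Subtype.ext (D.eq_zero_of_integralForm_mul (D.harmonicProj _).2 fun y hy => ?_)
  have hy' := D.harmonic_le_small r hy
  rw [D.integralForm_harmonicProj_mul _ hy, mul_assoc]
  exact (D.integralForm_mul_of_harmonicProj_eq_zero hr hn (D.mul_mem_small hr hconn hz hy') ht
    (h1 y hy')).2

/-- The harmonic projection is multiplicative modulo coboundaries on the small subspace. -/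
theorem harmonicProj_mul {r : ℕ} (hr : 1 < r) (hn : n ≤ 4 * r - 2)
    (hconn : A.IsConnectedUpTo (r - 1)) {a b : A.carrier} (ha : a ∈ D.small r)
    (hb : b ∈ D.small r) :
    D.harmonicProj (a * b) =
      D.harmonicProj ((D.harmonicProj a : A.carrier) * D.harmonicProj b) := by
  have hPP : ∀ c, D.harmonicProj (c - D.harmonicProj c) = 0 := fun c => by
    rw [map_sub, sub_eq_zero]
    exact Subtype.ext (D.harmonicProj_harmonic (D.harmonicProj c).2).symm
  have hPm : ∀ c, (D.harmonicProj c : A.carrier) ∈ D.small r := fun c =>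
    D.harmonic_le_small r (D.harmonicProj c).2
  have e : a * b = (D.harmonicProj a : A.carrier) * D.harmonicProj b +
      ((a - D.harmonicProj a) * b + D.harmonicProj a * (b - D.harmonicProj b)) := by
    noncomm_ring
  rw [e, map_add, map_add,
    (D.harmonicProj_mul_eq_zero hr hn hconn (sub_mem ha (hPm a)) hb (hPP a)).1,
    (D.harmonicProj_mul_eq_zero hr hn hconn (sub_mem hb (hPm b)) (hPm a) (hPP b)).2,
    add_zero, add_zero]

/-- The small subspace of an `(r-1)`-connected Poincaré DGCA as a subalgebra. -/
def smallSubalgebra {r : ℕ} (hr : 1 < r) (hconn : A.IsConnectedUpTo (r - 1)) :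
    Subalgebra F A.carrier :=
  (D.small r).toSubalgebra (D.harmonic_le_small r D.one_mem_harmonic)
    fun _ _ => D.mul_mem_small hr hconn

/-- The small subspace of an `(r-1)`-connected Poincaré DGCA as a DGCA. -/
noncomputable def smallDGCA {r : ℕ} (hr : 1 < r) (hconn : A.IsConnectedUpTo (r - 1)) :
    DGCA.{u, v} F :=
  A.ofSubalgebra (D.smallSubalgebra hr hconn) (D.small_isHomogeneous r)
    fun _ => D.d_mem_small

theorem smallDGCA_existsQuasiIso {r : ℕ} (hr : 1 < r) (hconn : A.IsConnectedUpTo (r - 1)) :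
    DGCA.ExistsQuasiIso (D.smallDGCA hr hconn) A.toDGCA := by
  refine ⟨(D.smallSubalgebra hr hconn).val, fun i a ha => ha, ⟨fun x => rfl, ?_, ?_⟩⟩
  · rintro ⟨x, hx⟩ hdx ⟨y, hy⟩
    change A.d y = x at hy
    refine ⟨⟨D.homotopy x, D.homotopy_mem_small hx⟩, Subtype.ext ?_⟩
    change A.d (D.homotopy x) = x
    rw [D.d_homotopy, ← hy, D.harmonicProj_d, A.d_d]
    simp
  · intro y hy
    refine ⟨⟨D.harmonicProj y, D.harmonic_le_small r (D.harmonicProj y).2⟩,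
      Subtype.ext (D.d_harmonic (D.harmonicProj y).2), D.homotopy y, ?_⟩
    rw [D.d_homotopy, hy, map_zero, sub_zero]
    rfl

/-- The cohomology class of the harmonic part. -/
noncomputable def harmonicClass : A.carrier →ₗ[F] A.cohomology.carrier :=
  A.cls.toLinearMap ∘ₗ LinearMap.codRestrict (Subalgebra.toSubmodule A.cocycles)
    (D.harmonic.subtype ∘ₗ D.harmonicProj) fun a => D.d_harmonic (D.harmonicProj a).2

theorem harmonicClass_apply (a : A.carrier) :
    D.harmonicClass a = A.cls ⟨D.harmonicProj a, D.d_harmonic (D.harmonicProj a).2⟩ := rfl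

theorem harmonicClass_cocycle (z : A.cocycles) : D.harmonicClass z = A.cls z := by
  rw [harmonicClass_apply, ← sub_eq_zero, ← map_sub, A.cls_eq_zero_iff]
  refine ⟨-D.homotopy z, ?_⟩
  have hz : A.d (z : A.carrier) = 0 := z.2
  rw [map_neg, D.d_homotopy, hz, map_zero, sub_zero, neg_sub]
  rfl

theorem smallDGCA_existsQuasiIso_cohomology {r : ℕ} (hr : 1 < r) (hn : n ≤ 4 * r - 2)
    (hconn : A.IsConnectedUpTo (r - 1)) :
    DGCA.ExistsQuasiIso (D.smallDGCA hr hconn) A.cohomology.toDGCA := by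
  have h1 : D.harmonicClass 1 = 1 := by
    have h := D.harmonicClass_cocycle 1
    rwa [map_one] at h
  have hmul : ∀ a b : D.smallSubalgebra hr hconn,
      D.harmonicClass ((a : A.carrier) * b) = D.harmonicClass a * D.harmonicClass b := by
    rintro ⟨a, ha⟩ ⟨b, hb⟩
    rw [harmonicClass_apply D a, harmonicClass_apply D b, ← map_mul, ← D.harmonicClass_cocycle,
      harmonicClass_apply, harmonicClass_apply]
    congr 1
    exact Subtype.ext (congrArg (Subtype.val : D.harmonic → A.carrier)
      (D.harmonicProj_mul hr hn hconn ha hb))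
  let f : D.smallSubalgebra hr hconn →ₐ[F] A.cohomology.carrier :=
    AlgHom.ofLinearMap (D.harmonicClass ∘ₗ (D.smallSubalgebra hr hconn).val.toLinearMap) h1 hmul
  refine ⟨f, ?_, ⟨?_, ?_, ?_⟩⟩
  · rintro i ⟨a, _⟩ ha
    exact A.cls_mem (D.contraction.proj_mem i a ha)
  · rintro ⟨x, hx⟩
    change D.harmonicClass (A.d x) = 0
    have h := D.harmonicClass_cocycle ⟨A.d x, A.d_d x⟩
    rw [show D.harmonicClass (A.d x) = _ from h, A.cls_eq_zero_iff]
    exact ⟨x, rfl⟩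
  · rintro ⟨x, hx⟩ hdx ⟨y, hy⟩
    replace hdx : A.d x = 0 := congrArg Subtype.val hdx
    replace hy : 0 = D.harmonicClass x := hy
    refine ⟨⟨D.homotopy x, D.homotopy_mem_small hx⟩, Subtype.ext ?_⟩
    change A.d (D.homotopy x) = x
    rw [D.d_homotopy, D.eq_zero_of_cls_eq_zero (D.harmonicProj x).2 hy.symm, hdx]
    simp
  · intro c _
    obtain ⟨y, hy, rfl⟩ := D.exists_harmonic c
    refine ⟨⟨y, D.harmonic_le_small r hy⟩, Subtype.ext (D.d_harmonic hy), 0, ?_⟩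
    change (0 : A.cohomology.carrier) = A.cls ⟨y, D.d_harmonic hy⟩ - D.harmonicClass y
    exact (sub_eq_zero.2 (D.harmonicClass_cocycle ⟨y, D.d_harmonic hy⟩).symm).symm

end PoincareDGCA.HodgeDecomposition

theorem theorem4p1 {F : Type v} [Field F] [CharZero F] {n r : ℕ} (hr : 1 < r) (hn : n ≤ 5 * r - 3)
    (A : PoincareDGCA.{u, v} F n) (hconn : A.IsConnectedUpTo (r - 1)) (D : A.HodgeDecomposition)
    (W : Submodule F A.cohomology.carrier) (hW : A.cohomology.IsGenerating W)
    (hD : A.IsAdapted D.harmonic W) :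
    (∃ M : AInfinityStructure D.harmonicSpace,
      M.m 1 = 0 ∧ (∀ k, 4 ≤ k → M.m k = 0) ∧
      (∃ φ : AInfinityHom M A.toAInfinity, φ.IsQuasiIso) ∧
      (n ≤ 4 * r - 2 → M.m 3 = 0)) ∧
    (n ≤ 4 * r - 2 → A.IsFormal) := by
  refine ⟨⟨D.contraction.transfer, D.contraction.transfer_one, fun k hk => ?_,
    ⟨D.contraction.transferHom, D.contraction.transferHom_isQuasiIso⟩, fun h => ?_⟩, fun h => ?_⟩
  · refine D.transfer_m_eq_zero hr hconn (by omega) ?_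
    obtain ⟨j, rfl⟩ := Nat.exists_eq_add_of_le hk
    have h1 : n + 3 ≤ 5 * r := by omega
    nlinarith [Nat.mul_le_mul_left j hr.le]
  · exact D.transfer_m_eq_zero hr hconn le_rfl (by omega)
  · exact (Relation.EqvGen.symm _ _ (.rel _ _ (D.smallDGCA_existsQuasiIso hr hconn))).trans _ _ _
      (.rel _ _ (D.smallDGCA_existsQuasiIso_cohomology hr h hconn))
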